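/- A pseudogroup $\mathcal H$ of local transformations of a topological space $Z$ is a collection of homeomorphisms between open subsets of $Z$ that contains $\mathrm{id}_Z$ and is closed under composition (on the maximal domain), inversion, restriction to open sets and combination. A symmetric (closed under inversion) set $E\subset\mathcal H$ generates $\mathcal H$ if $\mathcal H$ is the smallest pseudogroup containing $E$. The orbit of $x$ is $\mathcal H(x)=\{h(x): h\in\mathcal H,\ x\in\operatorname{dom}h\}$; the orbit space $Z/\mathcal H$ carries the quotient topology. The group of germs of an orbit is the group of germs at $x$ of the $h\in\mathcal H$ with $h(x)=x$, for any point $x$ of the orbit. The restriction of $\mathcal H$ to an open set $U$ is the pseudogroup on $U$ of all $h\in\mathcal H$ with domain and image in $U$. For a relatively compact open set $U\subset Z$ meeting every $\mathcal H$-orbit, a system of compact generation of $\mathcal H$ on $U$ is a finite symmetric set $E$ of generators of the restriction $\mathcal G$ of $\mathcal H$ to $U$ such that each $g\in E$ is the restriction of some $\bar g\in\mathcal H$ with $\overline{\operatorname{dom} g}\subset\operatorname{dom}\bar g$. If such $U$ and $E$ exist, $\mathcal H$ is compactly generated. For $h\in\mathcal G$ and $x\in\operatorname{dom}h$, put $|h|_{E,x}=0$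 if $h$ is the identity around $x$, and otherwise let $|h|_{E,x}$ be the least $k\geq 1$ such that $h=h_k\circ\dots\circ h_1$ around $x$ with $h_1,\dots,h_k\in E$. On each $\mathcal G$-orbit, $d_E(x,y)=\min\{|h|_{E,x}: h\in\mathcal G,\ x\in\operatorname{dom}h,\ h(x)=y\}$ is a metric. The system $E$ is recurrent if there are an open $V\subset U$, with compact closure in $U$, and $R>0$ such that for every $x\in U$ there is $h\in\mathcal G$ with $x\in\operatorname{dom}h$, $|h|_{E,x}<R$ and $h(x)\in V$. A cover of $Z$ by quasi-locally equal metric spaces is a family of metric spaces $(Z_i,d_i)_{i\in I}$ whose underlying sets cover $Z$, such that $Z_i\cap Z_j$ is open in $(Z_i,d_i)$ and in $(Z_j,d_j)$ for all $i,j\in I$, and such that there is an assignment $\epsilon\mapsto\delta(\epsilon)>0$ for which every $z\in Z_i\cap Z_j$ ($i,j\in I$) has a neighborhood $W\subset Z_i\cap Z_j$, open for both $d_i$ and $d_j$, with $d_i(x,y)<\delta(\epsilon)\Rightarrow d_j(x,y)<\epsilon$ for all $\epsilon>0$ and $x,y\in W$. It induces the topology of $Z$ if the open balls of the $(Z_i,d_i)$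 form a base of it. $\mathcal H$ is strongly equicontinuous if there are such a cover inducing the topology of $Z$ and a symmetric set $S$ of generators of $\mathcal H$, closed under composition, such that for every $\epsilon>0$ there is $\delta>0$ with $d_i(x,y)<\delta\Rightarrow d_j(h(x),h(y))<\epsilon$ for all $h\in S$, $i,j\in I$ and $x,y\in Z_i\cap\operatorname{dom}h$ with $h(x),h(y)\in Z_j$. $\mathcal H$ is quasi-effective if it is generated by a symmetric set $S$, closed under composition, such that every $h\in S$ that is the identity on some non-empty open subset of its domain is the identity on its domain. **Theorem.** Let $\mathcal H$ be a compactly generated, strongly equicontinuous and quasi-effective pseudogroup of local transformations of a locally compact Polish space $Z$ such that $Z/\mathcal H$ is connected. Let $\mathcal G$ be the restriction of $\mathcal H$ to a relatively compact open set $U\subset Z$ that meets every orbit, and let $E$ be any recurrent system of compact generation of $\mathcal H$ on $U$. Then, with the metrics $d_E$, all $\mathcal G$-orbits with trivial group of germs are uniformly coarsely quasi-isometric to each other: there are constants $C,K>0$ such that, for any two $\mathcal G$-orbits $\mathcal O,\mathcal O'$ with trivial group of germs, there are subsets $A\subset\mathcal O$, $A'\subset\mathcal O'$ and a bijection $f:A\to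 A'$ such that every point of $\mathcal O$ is at $d_E$-distance less than $C$ from $A$, every point of $\mathcal O'$ is at $d_E$-distance less than $C$ from $A'$, and $\frac1K\,d_E(a,b)\le d_E(f(a),f(b))\le K\,d_E(a,b)$ for all $a,b\in A$. -/

import Mathlib

open Set Topology TopologicalSpace

universe u

/- A pseudogroup of local transformations of `X` is a `G : StructureGroupoid X` (closed under
composition, inversion and combination, containing the identity) together with
`[ClosedUnderRestriction G]` (closed under restriction to open sets). -/

namespace LocalPseudogroup

section Basic

variable {X : Type u} [TopologicalSpace X]

/-- A set of local transformations is symmetric if it contains the inverse of each of its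
elements.  Local transformations are identified when they have the same domain and agree on it. -/
def IsSymmetric (E : Set (OpenPartialHomeomorph X X)) : Prop :=
  ∀ e ∈ E, ∃ e' ∈ E, e'.EqOnSource e.symm

/-- Closed under composition (with the maximal domain where the composite makes sense). -/
def IsClosedUnderComp (S : Set (OpenPartialHomeomorph X X)) : Prop :=
  ∀ e ∈ S, ∀ e' ∈ S, ∃ e'' ∈ S, e''.EqOnSource (e.trans e')

/-- `E` generates the pseudogroup `G`: `G` is the smallest pseudogroup containing `E`. -/
def Generates (E : Set (OpenPartialHomeomorph X X)) (G : StructureGroupoid X) : Prop :=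
  (∀ e ∈ E, e ∈ G) ∧
    ∀ G' : StructureGroupoid X, ClosedUnderRestriction G' → (∀ e ∈ E, e ∈ G') → G ≤ G'

/-- The orbit of `x`. -/
def orbit (G : StructureGroupoid X) (x : X) : Set X :=
  {y | ∃ h ∈ G, x ∈ h.source ∧ h x = y}

/-- The equivalence relation whose classes are the orbits. -/
def orbitSetoid (G : StructureGroupoid X) : Setoid X where
  r x y := y ∈ orbit G x
  iseqv :=
    { refl := fun x => ⟨OpenPartialHomeomorph.refl X, G.id_mem, mem_univ x, rfl⟩
      symm := by
        rintro x y ⟨h, hG, hx, rfl⟩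
        exact ⟨h.symm, G.symm hG, h.map_source hx, h.left_inv hx⟩
      trans := by
        rintro x y z ⟨h, hG, hx, rfl⟩ ⟨k, kG, hy, rfl⟩
        exact ⟨h.trans k, G.trans hG kG, by simp [hx, hy], by simp⟩ }

/-- The space of orbits; as a `Quotient` it carries the quotient topology. -/
abbrev OrbitSpace (G : StructureGroupoid X) : Type u := Quotient (orbitSetoid G)

/-- `U` meets every orbit. -/
def MeetsEveryOrbit (G : StructureGroupoid X) (U : Set X) : Prop :=
  ∀ x, (orbit G x ∩ U).Nonempty

/-- The group of germs at `x` of the elements of `G` fixing `x` is trivial (equivalently, the group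
of germs of the orbit of `x` is trivial). -/
def HasTrivialGermGroup (G : StructureGroupoid X) (x : X) : Prop :=
  ∀ h ∈ G, x ∈ h.source → h x = x → ∀ᶠ y in 𝓝 x, h y = y

/-- The composite `hₖ ∘ ⋯ ∘ h₁` of the list `[h₁, …, hₖ]`, on its maximal domain. -/
noncomputable def listComp :
    List (OpenPartialHomeomorph X X) → OpenPartialHomeomorph X X
  | [] => OpenPartialHomeomorph.refl X
  | h :: l => h.trans (listComp l)

open Classical in
/-- The length `|h|_{E,x}`: zero if `h` is the identity around `x`, and otherwise the least positive
`k` such that `h = hₖ ∘ ⋯ ∘ h₁` around `x` with all `hᵢ ∈ E`.  If `E` is a symmetric set of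
generators of a pseudogroup, `h` belongs to it and `x` is in the domain of `h`, such a `k` exists. -/
noncomputable def germLength (E : Set (OpenPartialHomeomorph X X))
    (h : OpenPartialHomeomorph X X) (x : X) : ℕ :=
  if ∀ᶠ y in 𝓝 x, h y = y then 0
  else sInf {k | 0 < k ∧ ∃ l : List (OpenPartialHomeomorph X X), l.length = k ∧ (∀ e ∈ l, e ∈ E) ∧
    x ∈ (listComp l).source ∧ ∀ᶠ y in 𝓝 x, h y = listComp l y}

/-- The metric `d_E` on the orbits of `G`: the least length at `x` of an element of `G` mapping
`x` to `y`.  It is only used for `x`, `y` in the same orbit and `E` a symmetric set of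
generators of `G`. -/
noncomputable def orbitDist (G : StructureGroupoid X) (E : Set (OpenPartialHomeomorph X X))
    (x y : X) : ℕ :=
  sInf {n | ∃ h ∈ G, x ∈ h.source ∧ h x = y ∧ germLength E h x = n}

/-- A set `E` of generators of the pseudogroup `G` on `X` is recurrent if there are a relatively
compact open subset `V` of `X` and `R > 0` such that every `d_E`-ball of radius `R` in every
orbit meets `V`. -/
def IsRecurrent (G : StructureGroupoid X) (E : Set (OpenPartialHomeomorph X X)) : Prop :=
  ∃ V : Set X, IsOpen V ∧ IsCompact (closure V) ∧ ∃ R : ℝ, 0 < R ∧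
    ∀ x, ∃ h ∈ G, x ∈ h.source ∧ (germLength E h x : ℝ) < R ∧ h x ∈ V

end Basic

section Restriction

variable {Z : Type u} [TopologicalSpace Z]

open Classical in
/-- A homeomorphism between open subsets of the open set `U`, regarded as a homeomorphism between
open subsets of `Z`. -/
noncomputable def extendOpen (U : Opens Z) (e : OpenPartialHomeomorph U U) :
    OpenPartialHomeomorph Z Z where
  toFun z := if h : z ∈ U then (e ⟨z, h⟩ : Z) else z
  invFun z := if h : z ∈ U then (e.symm ⟨z, h⟩ : Z) else z
  source := Subtype.val '' e.source
  target := Subtype.val '' e.target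
  map_source' := by
    rintro _ ⟨x, hx, rfl⟩
    exact ⟨e x, e.map_source hx, by simp⟩
  map_target' := by
    rintro _ ⟨x, hx, rfl⟩
    exact ⟨e.symm x, e.map_target hx, by simp⟩
  left_inv' := by
    rintro _ ⟨x, hx, rfl⟩
    simp [e.left_inv hx]
  right_inv' := by
    rintro _ ⟨x, hx, rfl⟩
    simp [e.right_inv hx]
  open_source := U.isOpen.isOpenMap_subtype_val _ e.open_source
  open_target := U.isOpen.isOpenMap_subtype_val _ e.open_target
  continuousOn_toFun := by
    rintro _ ⟨x, hx, rfl⟩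
    apply ContinuousAt.continuousWithinAt
    rw [← U.isOpen.isOpenEmbedding_subtypeVal.continuousAt_iff]
    refine (continuous_subtype_val.continuousAt.comp (e.continuousAt hx)).congr ?_
    exact Filter.Eventually.of_forall fun y => by simp
  continuousOn_invFun := by
    rintro _ ⟨x, hx, rfl⟩
    apply ContinuousAt.continuousWithinAt
    rw [← U.isOpen.isOpenEmbedding_subtypeVal.continuousAt_iff]
    refine (continuous_subtype_val.continuousAt.comp (e.symm.continuousAt hx)).congr ?_
    exact Filter.Eventually.of_forall fun y => by simp

theorem extendOpen_source (U : Opens Z) (e : OpenPartialHomeomorph U U) :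
    (extendOpen U e).source = Subtype.val '' e.source := rfl

theorem extendOpen_symm (U : Opens Z) (e : OpenPartialHomeomorph U U) :
    (extendOpen U e).symm = extendOpen U e.symm := rfl

theorem extendOpen_coe (U : Opens Z) (e : OpenPartialHomeomorph U U) (x : U) :
    extendOpen U e (x : Z) = e x := by
  exact dif_pos x.2

theorem extendOpen_trans (U : Opens Z) (e e' : OpenPartialHomeomorph U U) :
    extendOpen U (e.trans e') ≈ (extendOpen U e).trans (extendOpen U e') := by
  refine ⟨?_, ?_⟩
  · ext z
    simp only [extendOpen_source, OpenPartialHomeomorph.trans_source, mem_image, mem_inter_iff,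
      mem_preimage]
    constructor
    · rintro ⟨x, ⟨h1, h2⟩, rfl⟩
      exact ⟨⟨x, h1, rfl⟩, e x, h2, (extendOpen_coe U e x).symm⟩
    · rintro ⟨⟨x, h1, rfl⟩, y, hy, hxy⟩
      rw [extendOpen_coe] at hxy
      obtain rfl := Subtype.val_injective hxy
      exact ⟨x, ⟨h1, hy⟩, rfl⟩
  · rintro _ ⟨x, hx, rfl⟩
    simp [extendOpen_coe]

theorem extendOpen_restr (U : Opens Z) (e : OpenPartialHomeomorph U U) (s : Set U)
    (hs : IsOpen s) :
    extendOpen U (e.restr s) ≈ (extendOpen U e).restr (Subtype.val '' s) := by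
  have hs' : IsOpen ((Subtype.val : U → Z) '' s) := U.isOpen.isOpenMap_subtype_val _ hs
  refine ⟨?_, ?_⟩
  · rw [extendOpen_source, OpenPartialHomeomorph.restr_source' _ _ hs,
      OpenPartialHomeomorph.restr_source' _ _ hs', extendOpen_source,
      image_inter Subtype.val_injective]
  · rintro _ ⟨x, hx, rfl⟩
    simp [extendOpen_coe]

theorem extendOpen_congr (U : Opens Z) {e e' : OpenPartialHomeomorph U U} (h : e' ≈ e) :
    extendOpen U e' ≈ extendOpen U e := by
  refine ⟨?_, ?_⟩
  · rw [extendOpen_source, extendOpen_source, h.1]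
  · rintro _ ⟨x, hx, rfl⟩
    rw [extendOpen_coe, extendOpen_coe, h.2 hx]

/-- The restriction of the pseudogroup `H` on `Z` to the open set `U`: the pseudogroup on the space
`U` consisting of the elements of `H` whose domain and image are contained in `U`. -/
noncomputable def restriction (H : StructureGroupoid Z) [ClosedUnderRestriction H] (U : Opens Z) :
    StructureGroupoid U where
  members := {e | extendOpen U e ∈ H}
  trans' e e' he he' := H.mem_of_eqOnSource (H.trans he he') (extendOpen_trans U e e')
  symm' e he := by
    have := H.symm he
    rwa [extendOpen_symm] at this
  id_mem' := by
    refine H.mem_of_eqOnSource (closedUnderRestriction' H.id_mem U.isOpen) ⟨?_, ?_⟩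
    · rw [OpenPartialHomeomorph.restr_source' _ _ U.isOpen, extendOpen_source]
      simp
    · rintro _ ⟨x, hx, rfl⟩
      rw [extendOpen_coe]
      simp
  locality' e he := by
    refine H.locality ?_
    rintro _ ⟨x, hx, rfl⟩
    obtain ⟨s, hs, hxs, hmem⟩ := he x hx
    exact ⟨Subtype.val '' s, U.isOpen.isOpenMap_subtype_val _ hs, ⟨x, hxs, rfl⟩,
      H.mem_of_eqOnSource hmem (Setoid.symm (extendOpen_restr U e s hs))⟩
  mem_of_eqOnSource' e e' he h := H.mem_of_eqOnSource he (extendOpen_congr U h)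

instance restriction_closedUnderRestriction (H : StructureGroupoid Z) [ClosedUnderRestriction H]
    (U : Opens Z) : ClosedUnderRestriction (restriction H U) where
  closedUnderRestriction := by
    intro e he s hs
    have he' : extendOpen U e ∈ H := he
    exact H.mem_of_eqOnSource
      (closedUnderRestriction' he' (U.isOpen.isOpenMap_subtype_val _ hs))
      (extendOpen_restr U e s hs)

/-- `E` is a system of compact generation of `H` on `U`, where `U` is a relatively compact open
set meeting every orbit: a finite symmetric set of generators of the restriction of `H` to `U` such
that each `g ∈ E` is the restriction of some `g' ∈ H` defined on a neighbourhood of the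
closure (in `Z`) of the domain of `g`. -/
def IsSystemOfCompactGeneration (H : StructureGroupoid Z) [ClosedUnderRestriction H] (U : Opens Z)
    (E : Set (OpenPartialHomeomorph U U)) : Prop :=
  E.Finite ∧ IsSymmetric E ∧ Generates E (restriction H U) ∧
    ∀ g ∈ E, ∃ g' ∈ H, closure ((Subtype.val : U → Z) '' g.source) ⊆ g'.source ∧
      ∀ x ∈ g.source, g' (x : Z) = (g x : Z)

/-- Compactly generated pseudogroups. -/
def IsCompactlyGenerated (H : StructureGroupoid Z) [ClosedUnderRestriction H] : Prop :=
  ∃ U : Opens Z, IsCompact (closure (U : Set Z)) ∧ MeetsEveryOrbit H (U : Set Z) ∧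
    ∃ E : Set (OpenPartialHomeomorph U U), IsSystemOfCompactGeneration H U E

/-- A pseudogroup is quasi-effective if it is generated by some symmetric set `S`, closed under
compositions, such that each element of `S` that is the identity on some non-empty open subset of
its domain is the identity on its whole domain. -/
def IsQuasiEffective (H : StructureGroupoid Z) : Prop :=
  ∃ S : Set (OpenPartialHomeomorph Z Z), IsSymmetric S ∧ IsClosedUnderComp S ∧ Generates S H ∧
    ∀ h ∈ S, (∃ V : Set Z, IsOpen V ∧ V.Nonempty ∧ V ⊆ h.source ∧ ∀ x ∈ V, h x = x) →
      ∀ x ∈ h.source, h x = x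

end Restriction

section QuasiLocal

/-- A cover of the set `Z` by quasi-locally equal metric spaces `(Zᵢ, dᵢ)`.  A quasi-local metric
on `Z` is an equivalence class of such covers. -/
structure QuasiLocalCover (Z : Type u) where
  /-- The index set. -/
  ι : Type u
  /-- The sets `Zᵢ`. -/
  carrier : ι → Set Z
  /-- The metrics `dᵢ`. -/
  metric : ∀ i, MetricSpace (carrier i)
  cover : ∀ z, ∃ i, z ∈ carrier i
  isOpen_inter : ∀ i j,
    @IsOpen (carrier i) (metric i).toPseudoMetricSpace.toUniformSpace.toTopologicalSpace
      {z : carrier i | (z : Z) ∈ carrier j}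
  quasi_locally_equal : ∃ δ : ℝ → ℝ, (∀ ε, 0 < ε → 0 < δ ε) ∧
    ∀ (i j : ι) (z : Z), z ∈ carrier i → z ∈ carrier j →
      ∃ W : Set Z, z ∈ W ∧ ∃ (hi : W ⊆ carrier i) (hj : W ⊆ carrier j),
        @IsOpen (carrier i) (metric i).toPseudoMetricSpace.toUniformSpace.toTopologicalSpace
          {w : carrier i | (w : Z) ∈ W} ∧
        @IsOpen (carrier j) (metric j).toPseudoMetricSpace.toUniformSpace.toTopologicalSpace
          {w : carrier j | (w : Z) ∈ W} ∧
        ∀ ε, 0 < ε → ∀ (x y : Z) (hx : x ∈ W) (hy : y ∈ W),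
          (metric i).dist ⟨x, hi hx⟩ ⟨y, hi hy⟩ < δ ε →
            (metric j).dist ⟨x, hj hx⟩ ⟨y, hj hy⟩ < ε

/-- The open ball of center `x` and radius `r` in `(Zᵢ, dᵢ)`, as a subset of `Z`. -/
def QuasiLocalCover.ball {Z : Type u} (Q : QuasiLocalCover Z) (i : Q.ι) (x : Q.carrier i) (r : ℝ) :
    Set Z :=
  {z | ∃ hz : z ∈ Q.carrier i, (Q.metric i).dist ⟨z, hz⟩ x < r}

variable {Z : Type u} [TopologicalSpace Z]

/-- The quasi-local metric represented by `Q` induces the topology of `Z`: the open balls of the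
metric spaces `(Zᵢ, dᵢ)` form a base of it. -/
def QuasiLocalCover.InducesTopology (Q : QuasiLocalCover Z) : Prop :=
  IsTopologicalBasis {B : Set Z | ∃ (i : Q.ι) (x : Q.carrier i) (r : ℝ), 0 < r ∧ B = Q.ball i x r}

/-- Strong equicontinuity of a pseudogroup, with respect to some quasi-local metric inducing the
topology of `Z`. -/
def IsStronglyEquicontinuous (H : StructureGroupoid Z) : Prop :=
  ∃ Q : QuasiLocalCover Z, Q.InducesTopology ∧
    ∃ S : Set (OpenPartialHomeomorph Z Z), IsSymmetric S ∧ IsClosedUnderComp S ∧ Generates S H ∧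
      ∀ ε : ℝ, 0 < ε → ∃ δ : ℝ, 0 < δ ∧ ∀ h ∈ S, ∀ (i j : Q.ι) (x y : Z)
        (hx : x ∈ Q.carrier i) (hy : y ∈ Q.carrier i), x ∈ h.source → y ∈ h.source →
        ∀ (hx' : h x ∈ Q.carrier j) (hy' : h y ∈ Q.carrier j),
          (Q.metric i).dist ⟨x, hx⟩ ⟨y, hy⟩ < δ → (Q.metric j).dist ⟨h x, hx'⟩ ⟨h y, hy'⟩ < ε

end QuasiLocal

/-- There is a coarse quasi-isometry with coarse distortions `C` and `K` between `M` with the metric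
`d` and `M'` with the metric `d'`: a `K`-bi-Lipschitz bijection between `C`-nets. -/
def CoarselyQuasiIsometricWith {M M' : Type*} (d : M → M → ℝ) (d' : M' → M' → ℝ) (C K : ℝ) :
    Prop :=
  ∃ (A : Set M) (A' : Set M') (f : A ≃ A'),
    (∀ x, ∃ a ∈ A, d x a < C) ∧ (∀ x', ∃ a' ∈ A', d' x' a' < C) ∧
    ∀ a b : A, d' (f a) (f b) ≤ K * d a b ∧ d a b ≤ K * d' (f a) (f b)

end LocalPseudogroup

/-! Fix a metric on `Z` and extend each `g ∈ E` to an element `bar g` of `H` defined past the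
closure of its domain. Strong equicontinuity yields one radius, independent of word length, such
that around every point of the domain of any word in `E` the extended word is defined on the ball of
that radius and has small image there (`IsExtension.exists_extendsUniformly`). So the orbit of `x`
can be copied to the orbit of a nearby `x'`: a word `w` pairs `w x` with the image of `x'` under the
extended word.

Two things could go wrong. Different words may agree at `x` but not at `x'`; when the germ group at
`x` is trivial their extensions agree near `x`, and quasi-effectiveness propagates this to the whole
uniform ball (`eqOn_of_agreesOn`). Also, an extended word may leave `U` on the way, so it is not
spelled in `E` by the same letters. Recurrence allows working only with points in a compact part of
`U`, where compactness bounds the length of a new spelling (`IsExtension.exists_reach_bound`). Hence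
nearby orbits with trivial germs correspond coarsely, with uniform constants
(`exists_coarselyCorrespond_of_dist_lt`).

Coarse correspondences compose, and points with trivial germ group are dense by Baire. So "orbits
near `p` correspond to orbits near `q`" is an equivalence relation on `U` with open invariant
classes, and connectedness of the orbit space leaves a single class. The constants depend on `p` and
`q` until compactness of the closure of the recurrence set, which every orbit meets, makes them
uniform. Passing to separated nets turns a correspondence into a bi-Lipschitz bijection. -/

namespace LocalPseudogroup

/-! ### Words in the generators and the orbit metric. -/

section Words

variable {X : Type u} [TopologicalSpace X]

theorem mem_source_listComp_append (l l' : List (OpenPartialHomeomorph X X)) (x : X) :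
    x ∈ (listComp (l ++ l')).source ↔
      x ∈ (listComp l).source ∧ listComp l x ∈ (listComp l').source := by
  induction l generalizing x with
  | nil => simp [listComp]
  | cons g l ih => simp [listComp, ih, and_assoc]

theorem listComp_append_apply (l l' : List (OpenPartialHomeomorph X X)) (x : X) :
    listComp (l ++ l') x = listComp l' (listComp l x) := by
  induction l generalizing x with
  | nil => simp [listComp]
  | cons g l ih => simp [listComp, ih]

theorem listComp_mem {G : StructureGroupoid X} {w : List (OpenPartialHomeomorph X X)}
    (hw : ∀ e ∈ w, e ∈ G) : listComp w ∈ G := by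
  induction w with
  | nil => exact G.id_mem
  | cons g l ih =>
    exact G.trans (hw g (by simp)) (ih fun e he => hw e (by simp [he]))

/-- Around `x`, `h` is a composite of elements of `E`. -/
def IsWordAt (E : Set (OpenPartialHomeomorph X X)) (h : OpenPartialHomeomorph X X) (x : X) :
    Prop :=
  ∃ w : List (OpenPartialHomeomorph X X), (∀ e ∈ w, e ∈ E) ∧ x ∈ (listComp w).source ∧
    ∀ᶠ y in 𝓝 x, h y = listComp w y

variable {E : Set (OpenPartialHomeomorph X X)}

theorem IsWordAt.congr {h h' : OpenPartialHomeomorph X X} {x : X} (hh : IsWordAt E h x)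
    (heq : ∀ᶠ y in 𝓝 x, h' y = h y) : IsWordAt E h' x := by
  obtain ⟨w, hw, hx, hy⟩ := hh
  exact ⟨w, hw, hx, by filter_upwards [hy, heq] with y h1 h2; rw [h2, h1]⟩

theorem IsWordAt.trans {h h' : OpenPartialHomeomorph X X} {x : X} (hx : x ∈ h.source)
    (hh : IsWordAt E h x) (hh' : IsWordAt E h' (h x)) : IsWordAt E (h.trans h') x := by
  obtain ⟨w, hw, hwx, hy⟩ := hh
  obtain ⟨w', hw', hwx', hy'⟩ := hh'
  refine ⟨w ++ w', ?_, ?_, ?_⟩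
  · intro e he
    rcases List.mem_append.1 he with he | he
    exacts [hw e he, hw' e he]
  · rw [mem_source_listComp_append, ← hy.self_of_nhds]
    exact ⟨hwx, hwx'⟩
  · filter_upwards [hy, (h.continuousAt hx).eventually hy'] with y h1 h2
    rw [listComp_append_apply, ← h1, ← h2]
    rfl

theorem isWordAt_of_mem {g : OpenPartialHomeomorph X X} (hg : g ∈ E) {x : X} (hx : x ∈ g.source) :
    IsWordAt E g x :=
  ⟨[g], by simpa using hg, by simpa [listComp] using hx,
    Filter.Eventually.of_forall fun y => by simp [listComp]⟩

/-- The pseudogroup of the local transformations that are locally composites of elements of `E`, as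
are their inverses. -/
def wordGroupoid (E : Set (OpenPartialHomeomorph X X)) : StructureGroupoid X where
  members := {h | (∀ x ∈ h.source, IsWordAt E h x) ∧ ∀ x ∈ h.target, IsWordAt E h.symm x}
  trans' := by
    rintro e e' ⟨h1, h2⟩ ⟨h1', h2'⟩
    refine ⟨fun x hx => ?_, fun x hx => ?_⟩
    · rw [OpenPartialHomeomorph.trans_source] at hx
      exact (h1 x hx.1).trans hx.1 (h1' _ hx.2)
    · rw [OpenPartialHomeomorph.trans_target] at hx
      rw [OpenPartialHomeomorph.trans_symm_eq_symm_trans_symm]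
      exact (h2' x hx.1).trans hx.1 (h2 _ hx.2)
  symm' := by
    rintro e ⟨h1, h2⟩
    exact ⟨h2, by simpa using h1⟩
  id_mem' :=
    ⟨fun x _ => ⟨[], by simp, by simp [listComp], by simp [listComp]⟩,
      fun x _ => ⟨[], by simp, by simp [listComp], by simp [listComp]⟩⟩
  locality' := by
    intro e he
    refine ⟨fun x hx => ?_, fun y hy => ?_⟩
    · obtain ⟨s, hs, hxs, h1, -⟩ := he x hx
      refine (h1 x ?_).congr (Filter.Eventually.of_forall fun y => rfl)
      rw [e.restr_source' s hs]
      exact ⟨hx, hxs⟩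
    · obtain ⟨s, hs, hxs, -, h2⟩ := he (e.symm y) (e.map_target hy)
      refine (h2 y ?_).congr (Filter.Eventually.of_forall fun y => rfl)
      have := (e.restr s).map_source (x := e.symm y)
        (by rw [e.restr_source' s hs]; exact ⟨e.map_target hy, hxs⟩)
      simpa [e.right_inv hy] using this
  mem_of_eqOnSource' := by
    rintro e e' ⟨h1, h2⟩ h
    have key : ∀ {f f' : OpenPartialHomeomorph X X}, f' ≈ f → (∀ x ∈ f.source, IsWordAt E f x) →
        ∀ x ∈ f'.source, IsWordAt E f' x := by
      intro f f' hff hf x hx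
      refine (hf x (hff.1 ▸ hx)).congr ?_
      filter_upwards [f'.open_source.mem_nhds hx] with y hy using hff.2 hy
    exact ⟨key h h1, key (OpenPartialHomeomorph.EqOnSource.symm' h) h2⟩

instance wordGroupoid_closedUnderRestriction (E : Set (OpenPartialHomeomorph X X)) :
    ClosedUnderRestriction (wordGroupoid E) where
  closedUnderRestriction := by
    rintro e ⟨h1, h2⟩ s hs
    refine ⟨fun x hx => ?_, fun y hy => ?_⟩
    · rw [e.restr_source' s hs] at hx
      exact (h1 x hx.1).congr (Filter.Eventually.of_forall fun y => rfl)
    · refine (h2 y ?_).congr (Filter.Eventually.of_forall fun y => rfl)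
      have := (e.restr s).map_target hy
      rw [e.restr_source' s hs] at this
      have h3 := e.map_source this.1
      have h4 := (e.restr s).right_inv hy
      simp only [OpenPartialHomeomorph.restr_apply] at h4
      rwa [h4] at h3

/-- Minimality of `G`, applied to `wordGroupoid E`; symmetry of `E` is what makes the inverses of
generators words too. -/
theorem Generates.isWordAt {G : StructureGroupoid X} (hE : IsSymmetric E) (hG : Generates E G)
    {h : OpenPartialHomeomorph X X} (hh : h ∈ G) {x : X} (hx : x ∈ h.source) : IsWordAt E h x := by
  refine (hG.2 (wordGroupoid E) inferInstance (fun e he => ⟨fun x hx => isWordAt_of_mem he hx, ?_⟩)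
    hh).1 x hx
  intro x hx
  obtain ⟨e', he', heq⟩ := hE e he
  refine (isWordAt_of_mem he' (x := x) (heq.1 ▸ hx)).congr ?_
  filter_upwards [e.open_target.mem_nhds hx] with y hy
  exact (heq.2 (heq.1 ▸ hy)).symm

/-- `y` is the image of `x` by a composite of at most `n` elements of `E`. -/
def Reach (E : Set (OpenPartialHomeomorph X X)) (n : ℕ) (x y : X) : Prop :=
  ∃ w : List (OpenPartialHomeomorph X X), w.length ≤ n ∧ (∀ e ∈ w, e ∈ E) ∧
    x ∈ (listComp w).source ∧ listComp w x = y

theorem Reach.refl (n : ℕ) (x : X) : Reach E n x x :=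
  ⟨[], by simp, by simp, by simp [listComp], by simp [listComp]⟩

theorem Reach.mono {m n : ℕ} (h : m ≤ n) {x y : X} (hxy : Reach E m x y) : Reach E n x y := by
  obtain ⟨w, h1, h2⟩ := hxy
  exact ⟨w, h1.trans h, h2⟩

theorem Reach.trans {m n : ℕ} {x y z : X} (hxy : Reach E m x y) (hyz : Reach E n y z) :
    Reach E (m + n) x z := by
  obtain ⟨w, h1, h2, h3, rfl⟩ := hxy
  obtain ⟨w', h1', h2', h3', rfl⟩ := hyz
  refine ⟨w ++ w', by simp only [List.length_append]; omega, ?_, ?_, ?_⟩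
  · intro e he
    rcases List.mem_append.1 he with he | he
    exacts [h2 e he, h2' e he]
  · rw [mem_source_listComp_append]
    exact ⟨h3, h3'⟩
  · rw [listComp_append_apply]

theorem reach_one {g : OpenPartialHomeomorph X X} (hg : g ∈ E) {x : X} (hx : x ∈ g.source) :
    Reach E 1 x (g x) :=
  ⟨[g], by simp, by simpa using hg, by simpa [listComp] using hx, by simp [listComp]⟩

theorem Reach.symm (hE : IsSymmetric E) {n : ℕ} {x y : X} (h : Reach E n x y) :
    Reach E n y x := by
  obtain ⟨w, h1, h2, h3, rfl⟩ := h
  refine Reach.mono h1 ?_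
  clear h1 n
  induction w generalizing x with
  | nil => simpa [listComp] using Reach.refl 0 x
  | cons g l ih =>
    simp only [listComp, OpenPartialHomeomorph.trans_source, mem_inter_iff, mem_preimage] at h3
    have h4 := ih (fun e he => h2 e (by simp [he])) h3.2
    obtain ⟨g', hg', heq⟩ := hE g (h2 g (by simp))
    have h5 : g x ∈ g'.source := by
      rw [heq.1]
      exact g.map_source h3.1
    have h6 := reach_one hg' h5
    rw [heq.2 h5, g.left_inv h3.1] at h6
    simpa [listComp] using h4.trans h6

theorem Reach.mem_orbit {G : StructureGroupoid X} (hG : Generates E G) {n : ℕ} {x y : X}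
    (h : Reach E n x y) : y ∈ orbit G x := by
  obtain ⟨w, h1, h2, h3, rfl⟩ := h
  exact ⟨listComp w, listComp_mem fun e he => hG.1 e (h2 e he), h3, rfl⟩

theorem germLength_spec {G : StructureGroupoid X} (hE : IsSymmetric E) (hG : Generates E G)
    {h : OpenPartialHomeomorph X X} (hh : h ∈ G) {x : X} (hx : x ∈ h.source) :
    Reach E (germLength E h x) x (h x) := by
  unfold germLength
  split_ifs with hid
  · rw [hid.self_of_nhds]
    exact Reach.refl _ _
  · obtain ⟨w, hw, hwx, hy⟩ := hG.isWordAt hE hh hx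
    have hne : {k | 0 < k ∧ ∃ l : List (OpenPartialHomeomorph X X), l.length = k ∧
        (∀ e ∈ l, e ∈ E) ∧ x ∈ (listComp l).source ∧ ∀ᶠ y in 𝓝 x, h y = listComp l y}.Nonempty := by
      refine ⟨w.length, List.length_pos_iff.2 ?_, w, rfl, hw, hwx, hy⟩
      rintro rfl
      exact hid (by simpa [listComp] using hy)
    obtain ⟨-, l, hl, h1, h2, h3⟩ := Nat.sInf_mem hne
    exact ⟨l, hl.le, h1, h2, h3.self_of_nhds.symm⟩

/-- From here on only words and endpoints matter, no longer germs. The exceptional value 0 of the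
length at identity germs matches the empty word. -/
theorem orbitDist_le_iff {G : StructureGroupoid X} (hE : IsSymmetric E) (hG : Generates E G)
    {x y : X} (hxy : y ∈ orbit G x) {n : ℕ} : orbitDist G E x y ≤ n ↔ Reach E n x y := by
  constructor
  · intro h
    have hne : {n | ∃ h ∈ G, x ∈ h.source ∧ h x = y ∧ germLength E h x = n}.Nonempty := by
      obtain ⟨k, hk, hx, hy⟩ := hxy
      exact ⟨_, k, hk, hx, hy, rfl⟩
    obtain ⟨k, hk, hx, rfl, hlen⟩ := Nat.sInf_mem hne
    refine (germLength_spec hE hG hk hx).mono ?_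
    rw [hlen]
    exact h
  · rintro ⟨w, h1, h2, h3, rfl⟩
    refine le_trans ?_ h1
    have hle : orbitDist G E x (listComp w x) ≤ germLength E (listComp w) x :=
      Nat.sInf_le ⟨listComp w, listComp_mem fun e he => hG.1 e (h2 e he), h3, rfl, rfl⟩
    refine hle.trans ?_
    unfold germLength
    split_ifs with hid
    · exact Nat.zero_le _
    · refine Nat.sInf_le ⟨List.length_pos_iff.2 ?_, w, rfl, h2, h3,
        Filter.Eventually.of_forall fun _ => rfl⟩
      rintro rfl
      exact hid (by simp [listComp])

theorem orbit_eq_of_mem {G : StructureGroupoid X} {x y : X} (h : y ∈ orbit G x) :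
    orbit G y = orbit G x := by
  ext z
  exact ⟨fun hz => (orbitSetoid G).trans h hz,
    fun hz => (orbitSetoid G).trans ((orbitSetoid G).symm h) hz⟩

/-- Conjugation by an element carrying one point to the other. -/
theorem HasTrivialGermGroup.of_mem_orbit {G : StructureGroupoid X} {x y : X}
    (hx : HasTrivialGermGroup G x) (h : y ∈ orbit G x) : HasTrivialGermGroup G y := by
  obtain ⟨k, hk, hxk, rfl⟩ := h
  intro f hf hfs hfx
  have h1 := hx ((k.trans f).trans k.symm) (G.trans (G.trans hk hf) (G.symm hk))
    (by simp [hxk, hfs, hfx]) (by simp [hfx, k.left_inv hxk])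
  have h2 := (k.symm.continuousAt (k.map_source hxk)).eventually (by
    rw [k.left_inv hxk]
    exact h1)
  have h3 : ∀ᶠ y in 𝓝 (k x), f y ∈ k.target :=
    (f.continuousAt hfs).eventually (by
      rw [hfx]
      exact k.open_target.mem_nhds (k.map_source hxk))
  filter_upwards [h2, h3, k.open_target.mem_nhds (k.map_source hxk)] with y h4 h5 h6
  simp only [OpenPartialHomeomorph.coe_trans, Function.comp_apply, k.right_inv h6] at h4
  exact k.symm.injOn h5 h6 h4

end Words

end LocalPseudogroup

namespace LocalPseudogroup

/-! ### Coarse correspondences between pseudometric sets. -/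

section Coarse

variable {X : Type u}

/-- `d` is an integral pseudometric on the set `s`. -/
structure IsPseudoDistOn (d : X → X → ℕ) (s : Set X) : Prop where
  self : ∀ x ∈ s, d x x = 0
  symm : ∀ x ∈ s, ∀ y ∈ s, d x y = d y x
  triangle : ∀ x ∈ s, ∀ y ∈ s, ∀ z ∈ s, d x z ≤ d x y + d y z

/-- There is a relation between two `C`-nets of `s` and `t` that distorts distances at most in an
affine way, with constant `C`. -/
def CoarselyCorrespond (d : X → X → ℕ) (C : ℕ) (s t : Set X) : Prop :=
  ∃ R : X → X → Prop, (∀ a b, R a b → a ∈ s ∧ b ∈ t) ∧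
    (∀ a ∈ s, ∃ a' b, d a a' ≤ C ∧ R a' b) ∧ (∀ b ∈ t, ∃ a b', d b b' ≤ C ∧ R a b') ∧
    (∀ a b a' b', R a b → R a' b' → d b b' ≤ C * d a a' + C) ∧
    ∀ a b a' b', R a b → R a' b' → d a a' ≤ C * d b b' + C

variable {d : X → X → ℕ} {s t r : Set X} {C D : ℕ}

theorem CoarselyCorrespond.mono (h : C ≤ D) (H : CoarselyCorrespond d C s t) :
    CoarselyCorrespond d D s t := by
  obtain ⟨R, h0, h1, h2, h3, h4⟩ := H
  refine ⟨R, h0, fun a ha => ?_, fun b hb => ?_, fun a b a' b' h h' => ?_, fun a b a' b' h h' => ?_⟩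
  · obtain ⟨a', b, h5, h6⟩ := h1 a ha
    exact ⟨a', b, h5.trans h, h6⟩
  · obtain ⟨a', b, h5, h6⟩ := h2 b hb
    exact ⟨a', b, h5.trans h, h6⟩
  · exact (h3 _ _ _ _ h h').trans (by gcongr)
  · exact (h4 _ _ _ _ h h').trans (by gcongr)

theorem CoarselyCorrespond.symm (H : CoarselyCorrespond d C s t) : CoarselyCorrespond d C t s := by
  obtain ⟨R, h0, h1, h2, h3, h4⟩ := H
  refine ⟨fun a b => R b a, fun a b h => (h0 b a h).symm, fun a ha => ?_, fun a ha => ?_,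
    fun a b a' b' h h' => h4 _ _ _ _ h h', fun a b a' b' h h' => h3 _ _ _ _ h h'⟩
  · obtain ⟨x, y, h, h'⟩ := h2 a ha
    exact ⟨y, x, h, h'⟩
  · obtain ⟨x, y, h, h'⟩ := h1 a ha
    exact ⟨y, x, h, h'⟩

/-- The range of `R` and the domain of `R'` are only nets of `t` and need not meet, so relations are
composed with a gap `d b b' ≤ C`. Moving first to the domain of `R'` and then back to the range of
`R` costs at most `D + C` in `t`, hence `C * (C + D) + C` in `s`. -/
theorem exists_composite_net {R R' : X → X → Prop} (ht : IsPseudoDistOn d t)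
    (hs : IsPseudoDistOn d s)
    (h0 : ∀ a b, R a b → a ∈ s ∧ b ∈ t) (h1 : ∀ a ∈ s, ∃ a' b, d a a' ≤ C ∧ R a' b)
    (h2 : ∀ b ∈ t, ∃ a b', d b b' ≤ C ∧ R a b')
    (h4 : ∀ a b a' b', R a b → R a' b' → d a a' ≤ C * d b b' + C)
    (h0' : ∀ a b, R' a b → a ∈ t) (h1' : ∀ a ∈ t, ∃ a' b, d a a' ≤ D ∧ R' a' b) :
    ∀ a ∈ s, ∃ a' b b' c, d a a' ≤ C * (C + D) + 2 * C ∧ R a' b ∧ d b b' ≤ C ∧ R' b' c := by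
  intro a ha
  obtain ⟨a1, b1, h5, h6⟩ := h1 a ha
  obtain ⟨b2, c, h7, h8⟩ := h1' b1 (h0 _ _ h6).2
  obtain ⟨a3, b3, h9, h10⟩ := h2 b2 (h0' _ _ h8)
  have m1 := (h0 _ _ h6)
  have m2 := h0' _ _ h8
  have m3 := (h0 _ _ h10)
  have t1 := ht.triangle _ m1.2 _ m2 _ m3.2
  have t2 := h4 _ _ _ _ h6 h10
  have t3 := hs.triangle _ ha _ m1.1 _ m3.1
  have t4 : C * d b1 b3 ≤ C * (C + D) := Nat.mul_le_mul_left _ (by omega)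
  exact ⟨a3, b3, b2, c, by omega, h10, (ht.symm _ m3.2 _ m2).trans_le h9, h8⟩

theorem dist_le_of_composite {R R' : X → X → Prop} (ht : IsPseudoDistOn d t)
    (h0 : ∀ a b, R a b → b ∈ t) (h0' : ∀ a b, R' a b → a ∈ t)
    (h3 : ∀ a b a' b', R a b → R a' b' → d b b' ≤ C * d a a' + C)
    (h3' : ∀ a b a' b', R' a b → R' a' b' → d b b' ≤ D * d a a' + D) {e : ℕ}
    {a b b1 c a' b' b1' c' : X} (h : R a b) (hb : d b b1 ≤ e) (hc : R' b1 c) (h' : R a' b')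
    (hb' : d b' b1' ≤ e) (hc' : R' b1' c') :
    d c c' ≤ D * C * d a a' + (D * (C + 2 * e) + D) := by
  have t1 := ht.triangle _ (h0' _ _ hc) _ (h0 _ _ h) _ (h0' _ _ hc')
  have t2 := ht.triangle _ (h0 _ _ h) _ (h0 _ _ h') _ (h0' _ _ hc')
  have t3 := ht.symm _ (h0' _ _ hc) _ (h0 _ _ h)
  have t4 := h3 _ _ _ _ h h'
  have t5 := h3' _ _ _ _ hc hc'
  have t6 : D * d b1 b1' ≤ D * (C * d a a' + (C + 2 * e)) := Nat.mul_le_mul_left _ (by omega)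
  calc d c c' ≤ D * (C * d a a' + (C + 2 * e)) + D := by omega
    _ = _ := by ring

/-- The nets have constant `2 * C * C + 2 * C`, and the distortion has slope `C * C` and additive
term `3 * C * C + C`; the stated constant dominates all of them. -/
theorem CoarselyCorrespond.trans (hs : IsPseudoDistOn d s) (ht : IsPseudoDistOn d t)
    (hr : IsPseudoDistOn d r) (H : CoarselyCorrespond d C s t) (H' : CoarselyCorrespond d C t r) :
    CoarselyCorrespond d (5 * C * C + 4 * C) s r := by
  obtain ⟨R, h0, h1, h2, h3, h4⟩ := H
  obtain ⟨R', h0', h1', h2', h3', h4'⟩ := H'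
  refine ⟨fun a c => ∃ b b', R a b ∧ d b b' ≤ C ∧ R' b' c, ?_, ?_, ?_, ?_, ?_⟩
  · rintro a c ⟨b, b', h, -, h'⟩
    exact ⟨(h0 _ _ h).1, (h0' _ _ h').2⟩
  · intro a ha
    obtain ⟨a', b, b', c, h5, h6, h7, h8⟩ :=
      exists_composite_net ht hs h0 h1 h2 h4 (fun a b h => (h0' a b h).1) h1' a ha
    exact ⟨a', c, h5.trans (by nlinarith), b, b', h6, h7, h8⟩
  · intro c hc
    obtain ⟨a', b, b', a, h5, h6, h7, h8⟩ :=
      exists_composite_net (R := fun a b => R' b a) (R' := fun a b => R b a) (C := C) (D := C) ht hr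
        (fun a b h => (h0' b a h).symm)
        (fun c hc => by obtain ⟨x, y, h, h'⟩ := h2' c hc; exact ⟨y, x, h, h'⟩)
        (fun c hc => by obtain ⟨x, y, h, h'⟩ := h1' c hc; exact ⟨y, x, h, h'⟩)
        (fun a b a' b' h h' => h3' b a b' a' h h') (fun a b h => (h0 b a h).2)
        (fun c hc => by obtain ⟨x, y, h, h'⟩ := h2 c hc; exact ⟨y, x, h, h'⟩) c hc
    refine ⟨a, a', h5.trans (by nlinarith), b', b, h8, ?_, h6⟩
    rwa [ht.symm _ (h0 _ _ h8).2 _ (h0' _ _ h6).1]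
  · rintro a c a' c' ⟨b, b1, h, hb, hc⟩ ⟨b', b1', h', hb', hc'⟩
    have := dist_le_of_composite ht (fun a b h => (h0 a b h).2) (fun a b h => (h0' a b h).1) h3 h3'
      h hb hc h' hb' hc'
    refine this.trans ?_
    have : C * C * d a a' ≤ (5 * C * C + 4 * C) * d a a' := Nat.mul_le_mul_right _ (by nlinarith)
    nlinarith
  · rintro a c a' c' ⟨b, b1, h, hb, hc⟩ ⟨b', b1', h', hb', hc'⟩
    have := dist_le_of_composite (R := fun a b => R' b a) (R' := fun a b => R b a) (e := C) ht
      (fun a b h => (h0' b a h).1) (fun a b h => (h0 b a h).2)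
      (fun a b a' b' h h' => h4' b a b' a' h h') (fun a b a' b' h h' => h4 b a b' a' h h')
      hc (by rwa [ht.symm _ (h0' _ _ hc).1 _ (h0 _ _ h).2]) h
      hc' (by rwa [ht.symm _ (h0' _ _ hc').1 _ (h0 _ _ h').2]) h'
    refine this.trans ?_
    have : C * C * d c c' ≤ (5 * C * C + 4 * C) * d c c' := Nat.mul_le_mul_right _ (by nlinarith)
    nlinarith

/-- Every set contains a maximal `k`-separated subset. -/
theorem exists_maximal_separated (d : X → X → ℕ) (k : ℕ) (s : Set X)
    (hsymm : ∀ x ∈ s, ∀ y ∈ s, d x y = d y x) (hself : ∀ x ∈ s, d x x = 0) :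
    ∃ A ⊆ s, (∀ a ∈ A, ∀ b ∈ A, a ≠ b → k < d a b) ∧ ∀ x ∈ s, ∃ a ∈ A, d x a ≤ k := by
  obtain ⟨A, hA⟩ := zorn_subset {A : Set X | A ⊆ s ∧ ∀ a ∈ A, ∀ b ∈ A, a ≠ b → k < d a b} (by
    intro c hc hchain
    refine ⟨⋃₀ c, ⟨sUnion_subset fun A hA => (hc hA).1, ?_⟩, fun A hA => subset_sUnion_of_mem hA⟩
    rintro a ⟨A, hA, ha⟩ b ⟨B, hB, hb⟩ hab
    rcases hchain.total hA hB with h | h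
    · exact (hc hB).2 a (h ha) b hb hab
    · exact (hc hA).2 a ha b (h hb) hab)
  refine ⟨A, hA.prop.1, hA.prop.2, fun x hx => ?_⟩
  by_contra! hcon
  have hins : insert x A ∈ {A : Set X | A ⊆ s ∧ ∀ a ∈ A, ∀ b ∈ A, a ≠ b → k < d a b} := by
    refine ⟨insert_subset hx hA.prop.1, ?_⟩
    rintro a (rfl | ha) b (rfl | hb) hab
    · exact absurd rfl hab
    · exact hcon b hb
    · rw [hsymm a (hA.prop.1 ha) b hx]
      exact hcon a ha
    · exact hA.prop.2 a ha b hb hab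
  have hxA : x ∈ A := hA.le_of_ge hins (subset_insert x A) (mem_insert x A)
  have := hcon x hxA
  rw [hself x hx] at this
  omega

/-- On a maximal `2 * C`-separated subset of the domain of the relation, the additive error is
absorbed by the slope: distinct points are at distance more than `2 * C`, so their images cannot
coincide, and both distances are at least 1. Any choice of related points is then injective and
bi-Lipschitz. -/
theorem CoarselyCorrespond.coarselyQuasiIsometricWith (hs : IsPseudoDistOn d s)
    (ht : IsPseudoDistOn d t) (H : CoarselyCorrespond d C s t) :
    CoarselyQuasiIsometricWith (M := s) (M' := t) (fun p q => (d p q : ℝ))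
      (fun p q => (d p q : ℝ)) (2 * C * C + 4 * C + 1 : ℕ) (2 * C + 1 : ℕ) := by
  obtain ⟨R, h0, h1, h2, h3, h4⟩ := H
  have hdom : {a | ∃ b, R a b} ⊆ s := fun a ⟨b, hb⟩ => (h0 a b hb).1
  obtain ⟨A, hA, hsep, hnet⟩ := exists_maximal_separated d (2 * C) {a | ∃ b, R a b}
    (fun x hx y hy => hs.symm x (hdom hx) y (hdom hy)) (fun x hx => hs.self x (hdom hx))
  choose! f hf using fun a (ha : a ∈ A) => hA ha
  have hAs : ∀ a ∈ A, a ∈ s := fun a ha => hdom (hA ha)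
  have hft : ∀ a ∈ A, f a ∈ t := fun a ha => (h0 _ _ (hf a ha)).2
  have up : ∀ a ∈ A, ∀ b ∈ A, d (f a) (f b) ≤ (2 * C + 1) * d a b := by
    intro a ha b hb
    by_cases hab : a = b
    · subst hab
      rw [ht.self _ (hft a ha)]
      exact Nat.zero_le _
    · have g1 := hsep a ha b hb hab
      have g2 := h3 _ _ _ _ (hf a ha) (hf b hb)
      nlinarith
  have down : ∀ a ∈ A, ∀ b ∈ A, d a b ≤ (2 * C + 1) * d (f a) (f b) := by
    intro a ha b hb
    by_cases hab : a = b
    · subst hab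
      rw [hs.self _ (hAs a ha)]
      exact Nat.zero_le _
    · have g1 := hsep a ha b hb hab
      have g2 := h4 _ _ _ _ (hf a ha) (hf b hb)
      nlinarith
  have hinj : InjOn f A := by
    intro a ha b hb hab
    by_contra hne
    have g1 := hsep a ha b hb hne
    have g2 := down a ha b hb
    rw [hab, ht.self _ (hft b hb)] at g2
    omega
  -- Off `A` the value is irrelevant; `h1` merely supplies some point of `t`.
  have hex : ∀ a : s, ∃ b : t, (a : X) ∈ A → (b : X) = f a := by
    intro a
    by_cases ha : (a : X) ∈ A
    · exact ⟨⟨f a, hft a ha⟩, fun _ => rfl⟩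
    · obtain ⟨a', b, -, h⟩ := h1 a a.2
      exact ⟨⟨b, (h0 _ _ h).2⟩, fun h => absurd h ha⟩
  choose F hF using hex
  have hFinj : InjOn F {a : s | (a : X) ∈ A} := by
    intro a ha b hb hab
    apply Subtype.ext
    apply hinj ha hb
    rw [← hF a ha, ← hF b hb, hab]
  refine ⟨{a | (a : X) ∈ A}, F '' {a | (a : X) ∈ A}, Equiv.Set.imageOfInjOn F _ hFinj, ?_, ?_, ?_⟩
  · intro x
    obtain ⟨a', b, g1, g2⟩ := h1 x x.2
    obtain ⟨a, ha, g3⟩ := hnet a' ⟨b, g2⟩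
    refine ⟨⟨a, hAs a ha⟩, ha, ?_⟩
    have g4 := hs.triangle x x.2 a' (h0 _ _ g2).1 a (hAs a ha)
    have : d x a < 2 * C * C + 4 * C + 1 := by nlinarith
    show (d x a : ℝ) < _
    exact_mod_cast this
  · intro y
    obtain ⟨a', b, g1, g2⟩ := h2 y y.2
    obtain ⟨a, ha, g3⟩ := hnet a' ⟨b, g2⟩
    refine ⟨F ⟨a, hAs a ha⟩, ⟨⟨a, hAs a ha⟩, ha, rfl⟩, ?_⟩
    have g4 := ht.triangle y y.2 b (h0 _ _ g2).2 (f a) (hft a ha)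
    have g5 := h3 _ _ _ _ g2 (hf a ha)
    have : d y (f a) < 2 * C * C + 4 * C + 1 := by nlinarith
    simp only [hF ⟨a, hAs a ha⟩ ha]
    exact_mod_cast this
  · rintro ⟨a, ha⟩ ⟨b, hb⟩
    have e1 : ∀ (a : s) (ha : a ∈ {a : s | (a : X) ∈ A}),
        (((Equiv.Set.imageOfInjOn F _ hFinj) ⟨a, ha⟩ : t) : X) = f a := fun a ha => hF a ha
    beta_reduce
    rw [e1 a ha, e1 b hb]
    exact ⟨by exact_mod_cast up a ha b hb, by exact_mod_cast down a ha b hb⟩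

/-! ### Orbit pseudometrics and density of points with trivial germs. -/

variable [TopologicalSpace X]

theorem isPseudoDistOn_orbit {E : Set (OpenPartialHomeomorph X X)} {G : StructureGroupoid X}
    (hE : IsSymmetric E) (hG : Generates E G) (x : X) :
    IsPseudoDistOn (orbitDist G E) (orbit G x) := by
  have hmem : ∀ {y z}, y ∈ orbit G x → z ∈ orbit G x → z ∈ orbit G y := fun hy hz => by
    rwa [orbit_eq_of_mem hy]
  refine ⟨fun y hy => ?_, fun y hy z hz => ?_, fun y hy z hz w hw => ?_⟩
  · exact Nat.le_zero.1 ((orbitDist_le_iff hE hG (hmem hy hy)).2 (Reach.refl 0 y))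
  · exact le_antisymm
      ((orbitDist_le_iff hE hG (hmem hy hz)).2
        (((orbitDist_le_iff hE hG (hmem hz hy)).1 le_rfl).symm hE))
      ((orbitDist_le_iff hE hG (hmem hz hy)).2
        (((orbitDist_le_iff hE hG (hmem hy hz)).1 le_rfl).symm hE))
  · exact (orbitDist_le_iff hE hG (hmem hy hw)).2
      (((orbitDist_le_iff hE hG (hmem hy hz)).1 le_rfl).trans
        ((orbitDist_le_iff hE hG (hmem hz hw)).1 le_rfl))

/-- If `E` is countable, then the points with trivial group of germs are dense. -/
theorem dense_hasTrivialGermGroup [BaireSpace X] {E : Set (OpenPartialHomeomorph X X)}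
    {G : StructureGroupoid X} [T2Space X] (hE : IsSymmetric E) (hG : Generates E G)
    (hc : E.Countable) :
    Dense {x | HasTrivialGermGroup G x} := by
  have : Countable E := hc
  let B : List E → Set X := fun w =>
    {x | x ∈ (listComp (w.map Subtype.val)).source → listComp (w.map Subtype.val) x = x →
      ∀ᶠ y in 𝓝 x, listComp (w.map Subtype.val) y = y}
  have key : ∀ h : OpenPartialHomeomorph X X,
      {x | x ∈ h.source → h x = x → ∀ᶠ y in 𝓝 x, h y = y} ∈ residual X := by
    intro h
    -- An open dense set on which a fixed point of `h` has identity germ. Density: an open set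
    -- meeting the domain either contains a point moved by `h`, or `h` is the identity on the part
    -- of it in the domain.
    let O : Set X := {x | x ∈ h.source ∧ h x ≠ x} ∪ {x | ∀ᶠ y in 𝓝 x, h y = y} ∪
      (closure h.source)ᶜ
    have hO1 : IsOpen O := by
      refine (IsOpen.union ?_ isOpen_setOfPred_eventually_nhds).union isClosed_closure.isOpen_compl
      rw [isOpen_iff_mem_nhds]
      rintro x ⟨hx, hne⟩
      filter_upwards [h.open_source.mem_nhds hx,
        (h.continuousAt hx).prodMk continuousAt_id |>.eventually
          (isClosed_diagonal.isOpen_compl.mem_nhds (x := (h x, x)) hne)] with y hy hy'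
      exact ⟨hy, hy'⟩
    have hO2 : Dense O := by
      rw [dense_iff_inter_open]
      rintro V hV ⟨x, hx⟩
      by_cases hs : x ∈ closure h.source
      · obtain ⟨y, hyV, hys⟩ := mem_closure_iff.1 hs V hV hx
        by_cases hall : ∀ z ∈ V ∩ h.source, h z = z
        · exact ⟨y, hyV, Or.inl (Or.inr
            (Filter.mem_of_superset ((hV.inter h.open_source).mem_nhds ⟨hyV, hys⟩) hall))⟩
        · push Not at hall
          obtain ⟨z, hz, hne⟩ := hall
          exact ⟨z, hz.1, Or.inl (Or.inl ⟨hz.2, hne⟩)⟩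
      · exact ⟨x, hx, Or.inr hs⟩
    refine Filter.mem_of_superset (residual_of_dense_open hO1 hO2) ?_
    rintro x ((⟨-, h1⟩ | h1) | h1) hx hfix
    · exact absurd hfix h1
    · exact h1
    · exact absurd (subset_closure hx) h1
  -- There are countably many words, and every germ of `G` is the germ of a word.
  have hres : (⋂ w, B w) ∈ residual X := countable_iInter_mem.2 fun w => key _
  refine (dense_of_mem_residual hres).mono fun x hx h hh hxs hfix => ?_
  obtain ⟨w, hw, hwx, hwy⟩ := hG.isWordAt hE hh hxs
  lift w to List E using hw
  have h1 := mem_iInter.1 hx w hwx (hwy.self_of_nhds.symm.trans hfix)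
  filter_upwards [h1, hwy] with y h2 h3
  rw [h3, h2]

end Coarse

end LocalPseudogroup

namespace LocalPseudogroup

/-! ### From quasi-local metrics to a single metric. -/

section UniformEmbedding

variable {Y Z : Type*} [MetricSpace Y] [MetricSpace Z] {φ : Y → Z} {C : Set Z}

/-- Only `a` is confined to the compact set, not `b`: this is uniform continuity at the points of a
compact set, needed to compare each `dᵢ` with the metric of `Z`. -/
theorem _root_.Topology.IsOpenEmbedding.exists_dist_lt_of_isCompact (hφ : IsOpenEmbedding φ)
    (hC : IsCompact C) (hCφ : C ⊆ range φ) {ε : ℝ} (hε : 0 < ε) :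
    ∃ δ > 0, ∀ a b : Y, φ a ∈ C → dist a b < δ → dist (φ a) (φ b) < ε := by
  have hpre : IsCompact (φ ⁻¹' C) := hφ.isInducing.isCompact_preimage' hC hCφ
  have h := hpre.uniformContinuousAt_of_continuousAt φ (fun a _ => hφ.continuous.continuousAt)
    (Metric.dist_mem_uniformity hε)
  obtain ⟨δ, hδ, h⟩ := Metric.mem_uniformity_dist.1 h
  exact ⟨δ, hδ, fun a b ha hab => h hab ha⟩

/-- The same for the inverse of `φ`; a thickening of `C` inside the open range ensures that nearby
points of `Z` have preimages at all. -/
theorem _root_.Topology.IsOpenEmbedding.exists_dist_symm_lt_of_isCompact (hφ : IsOpenEmbedding φ)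
    (hC : IsCompact C) (hCφ : C ⊆ range φ) {ε : ℝ} (hε : 0 < ε) :
    ∃ δ > 0, ∀ a : Y, φ a ∈ C → ∀ z, dist (φ a) z < δ → ∃ b, φ b = z ∧ dist a b < ε := by
  rcases isEmpty_or_nonempty Y with hY | hY
  · exact ⟨1, one_pos, fun a => (hY.false a).elim⟩
  let g := (hφ.toOpenPartialHomeomorph φ).symm
  have hgs : g.source = range φ := by simp [g]
  have hgφ : ∀ a, g (φ a) = a := fun a => hφ.toOpenPartialHomeomorph_left_inv φ
  obtain ⟨δ, hδ, h⟩ := Metric.mem_uniformity_dist.1 (hC.uniformContinuousAt_of_continuousAt g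
    (fun a ha => g.continuousAt (by rw [hgs]; exact hCφ ha)) (Metric.dist_mem_uniformity hε))
  obtain ⟨δ', hδ', h'⟩ := hC.exists_thickening_subset_open hφ.isOpen_range hCφ
  refine ⟨min δ δ', lt_min hδ hδ', fun a ha z hz => ?_⟩
  obtain ⟨b, rfl⟩ := h' (Metric.mem_thickening_iff.2
    ⟨φ a, ha, by rw [dist_comm]; exact hz.trans_le (min_le_right _ _)⟩)
  refine ⟨b, rfl, ?_⟩
  have := h (hz.trans_le (min_le_left _ _)) ha
  simpa only [mem_ofPred_eq, hgφ] using this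

end UniformEmbedding

section QuasiLocalMetric

variable {Z : Type u}

theorem QuasiLocalCover.isOpen_carrier [TopologicalSpace Z] {Q : QuasiLocalCover Z}
    (hQ : Q.InducesTopology) (i : Q.ι) : IsOpen (Q.carrier i) := by
  have : Q.carrier i = ⋃ x : Q.carrier i, Q.ball i x 1 := by
    ext z
    simp only [mem_iUnion]
    constructor
    · intro hz
      exact ⟨⟨z, hz⟩, hz, by rw [(Q.metric i).dist_self]; exact one_pos⟩
    · rintro ⟨x, hz, -⟩
      exact hz
  rw [this]
  exact isOpen_iUnion fun x => hQ.isOpen ⟨i, x, 1, one_pos, rfl⟩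

/-- Continuity is where quasi-local equality enters: a ball of `d_k` contains a ball of `dᵢ` around
each of its points in the overlap. Openness holds because balls of `dᵢ` are open in `Z`. -/
theorem QuasiLocalCover.isOpenEmbedding [TopologicalSpace Z] {Q : QuasiLocalCover Z}
    (hQ : Q.InducesTopology) (i : Q.ι) :
    @IsOpenEmbedding (Q.carrier i) Z (Q.metric i).toPseudoMetricSpace.toUniformSpace.toTopologicalSpace
      _ Subtype.val := by
  let _ := Q.metric i
  let _ : TopologicalSpace (Q.carrier i) :=
    (Q.metric i).toPseudoMetricSpace.toUniformSpace.toTopologicalSpace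
  refine IsOpenEmbedding.of_continuous_injective_isOpenMap ?_ Subtype.val_injective ?_
  · refine hQ.continuous_iff.2 ?_
    rintro _ ⟨k, y, r, -, rfl⟩
    rw [Metric.isOpen_iff]
    rintro z ⟨hzk, hzr⟩
    obtain ⟨δ, hδ, hW⟩ := Q.quasi_locally_equal
    obtain ⟨W, hzW, hi, hk, hWi, -, hd⟩ := hW i k z z.2 hzk
    obtain ⟨s, hs, hsW⟩ := Metric.isOpen_iff.1 hWi z hzW
    have hr : 0 < r - (Q.metric k).dist ⟨z, hzk⟩ y := sub_pos.2 hzr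
    refine ⟨min s (δ _), lt_min hs (hδ _ hr), fun w hw => ?_⟩
    have hwW : (w : Z) ∈ W := hsW (Metric.ball_subset_ball (min_le_left _ _) hw)
    have h1 := hd _ hr z w hzW hwW (by
      rw [Metric.mem_ball, dist_comm] at hw
      exact hw.trans_le (min_le_right _ _))
    refine ⟨hk hwW, ?_⟩
    have h2 := (Q.metric k).dist_triangle ⟨w, hk hwW⟩ ⟨z, hzk⟩ y
    have h3 := (Q.metric k).dist_comm ⟨w, hk hwW⟩ ⟨z, hzk⟩
    linarith
  · intro O hO
    rw [isOpen_iff_mem_nhds]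
    rintro _ ⟨x, hx, rfl⟩
    obtain ⟨r, hr, hrO⟩ := Metric.isOpen_iff.1 hO x hx
    refine Filter.mem_of_superset ((hQ.isOpen ⟨i, x, r, hr, rfl⟩).mem_nhds
      ⟨x.2, (((Q.metric i).dist_self _).trans_lt hr)⟩) ?_
    rintro z ⟨hz, hzr⟩
    exact ⟨⟨z, hz⟩, hrO hzr, rfl⟩

/-- Strong equicontinuity in terms of a metric inducing the topology: the local transformations
in `S` are equicontinuous at the points of the compact set `K` which are mapped into `K`, as far as
nearby points are known to be mapped to `η`-near points. -/
def EquicontinuousOnWith [MetricSpace Z] (S : Set (OpenPartialHomeomorph Z Z)) (K : Set Z) (η : ℝ) :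
    Prop :=
  ∀ ε > 0, ∃ δ > 0, ∀ h ∈ S, ∀ x ∈ h.source, ∀ y ∈ h.source, x ∈ K → h x ∈ K →
    dist x y < δ → dist (h x) (h y) < η → dist (h x) (h y) < ε

theorem IsSymmetric.insert_refl {X : Type u} [TopologicalSpace X]
    {S : Set (OpenPartialHomeomorph X X)} (hS : IsSymmetric S) :
    IsSymmetric (insert (OpenPartialHomeomorph.refl X) S) := by
  rintro e (rfl | he)
  · exact ⟨_, mem_insert _ _, by
      rw [OpenPartialHomeomorph.refl_symm]
      exact OpenPartialHomeomorph.eqOnSource_refl _⟩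
  · obtain ⟨e', he', h⟩ := hS e he
    exact ⟨e', mem_insert_of_mem _ he', h⟩

theorem IsClosedUnderComp.insert_refl {X : Type u} [TopologicalSpace X]
    {S : Set (OpenPartialHomeomorph X X)} (hS : IsClosedUnderComp S) :
    IsClosedUnderComp (insert (OpenPartialHomeomorph.refl X) S) := by
  rintro e he e' he'
  rcases he with rfl | he
  · exact ⟨e', he', by
      rw [OpenPartialHomeomorph.refl_trans]
      exact OpenPartialHomeomorph.eqOnSource_refl _⟩
  · rcases he' with rfl | he'
    · exact ⟨e, mem_insert_of_mem _ he, by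
      rw [OpenPartialHomeomorph.trans_refl]
      exact OpenPartialHomeomorph.eqOnSource_refl _⟩
    · obtain ⟨e'', he'', h⟩ := hS e he e' he'
      exact ⟨e'', mem_insert_of_mem _ he'', h⟩

theorem Generates.insert_refl {X : Type u} [TopologicalSpace X]
    {S : Set (OpenPartialHomeomorph X X)} {G : StructureGroupoid X} (hS : Generates S G) :
    Generates (insert (OpenPartialHomeomorph.refl X) S) G := by
  refine ⟨?_, fun G' hG' h => hS.2 G' hG' fun e he => h e (mem_insert_of_mem _ he)⟩
  rintro e (rfl | he)
  · exact G.id_mem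
  · exact hS.1 e he

/-- Finitely many compact neighbourhoods, each inside one `Zᵢ`, cover `K`, and on each of them `dᵢ`
is uniformly comparable with the metric of `Z`. -/
theorem QuasiLocalCover.exists_equicontinuousOnWith [MetricSpace Z] [LocallyCompactSpace Z]
    {Q : QuasiLocalCover Z} (hQ : Q.InducesTopology) {S : Set (OpenPartialHomeomorph Z Z)}
    (hS : ∀ ε : ℝ, 0 < ε → ∃ δ : ℝ, 0 < δ ∧ ∀ h ∈ S, ∀ (i j : Q.ι) (x y : Z)
        (hx : x ∈ Q.carrier i) (hy : y ∈ Q.carrier i), x ∈ h.source → y ∈ h.source →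
        ∀ (hx' : h x ∈ Q.carrier j) (hy' : h y ∈ Q.carrier j),
          (Q.metric i).dist ⟨x, hx⟩ ⟨y, hy⟩ < δ → (Q.metric j).dist ⟨h x, hx'⟩ ⟨h y, hy'⟩ < ε)
    {K : Set Z} (hK : IsCompact K) : ∃ η > 0, EquicontinuousOnWith S K η := by
  choose i hi using Q.cover
  have hN : ∀ p : Z, ∃ N, IsCompact N ∧ N ∈ 𝓝 p ∧ N ⊆ Q.carrier (i p) := fun p => by
    obtain ⟨N, h1, h2, h3⟩ :=
      local_compact_nhds ((Q.isOpen_carrier hQ (i p)).mem_nhds (hi p))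
    exact ⟨N, h3, h1, h2⟩
  choose N hNc hNp hNi using hN
  obtain ⟨t, -, ht⟩ := hK.elim_nhds_subcover N fun p _ => hNp p
  have hr : ∀ p, N p ⊆ range (Subtype.val : Q.carrier (i p) → Z) := fun p => by
    rw [Subtype.range_val]; exact hNi p
  have toZ : ∀ ε > 0, ∀ p, ∃ δ > 0, ∀ a b : Q.carrier (i p), (a : Z) ∈ N p →
      (Q.metric (i p)).dist a b < δ → dist (a : Z) b < ε := fun ε hε p =>
    @IsOpenEmbedding.exists_dist_lt_of_isCompact _ _ (Q.metric (i p)) _ _ _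
      (Q.isOpenEmbedding hQ (i p)) (hNc p) (hr p) ε hε
  have ofZ : ∀ ε > 0, ∀ p, ∃ δ > 0, ∀ a : Q.carrier (i p), (a : Z) ∈ N p → ∀ z, dist (a : Z) z < δ →
      ∃ b : Q.carrier (i p), (b : Z) = z ∧ (Q.metric (i p)).dist a b < ε := fun ε hε p =>
    @IsOpenEmbedding.exists_dist_symm_lt_of_isCompact _ _ (Q.metric (i p)) _ _ _
      (Q.isOpenEmbedding hQ (i p)) (hNc p) (hr p) ε hε
  have hmin : ∀ f : Z → ℝ, (∀ p, 0 < f p) → ∃ δ > 0, ∀ p ∈ t, δ ≤ f p := fun f hf => by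
    rcases t.eq_empty_or_nonempty with rfl | hne
    · exact ⟨1, one_pos, by simp⟩
    · obtain ⟨q, hq, hmin⟩ := t.exists_min_image f hne
      exact ⟨f q, hf q, hmin⟩
  -- This `η` serves only to place `h y` in the same `Z_j` as `h x`, without which the hypothesis
  -- says nothing; the bound 1 is immaterial.
  choose η₀ hη₀ h1 using ofZ 1 one_pos
  obtain ⟨η, hη, hηle⟩ := hmin η₀ hη₀
  refine ⟨η, hη, fun ε hε => ?_⟩
  choose ε₁ hε₁ h2 using toZ ε hε
  obtain ⟨ε', hε', hε'le⟩ := hmin ε₁ hε₁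
  obtain ⟨δ', hδ', h3⟩ := hS ε' hε'
  choose δ₁ hδ₁ h4 using ofZ δ' hδ'
  obtain ⟨δ, hδ, hδle⟩ := hmin δ₁ hδ₁
  refine ⟨δ, hδ, fun h hh x hxs y hys hxK hhxK hxy hhxy => ?_⟩
  obtain ⟨p, hpt, hxp⟩ := mem_iUnion₂.1 (ht hxK)
  obtain ⟨q, hqt, hxq⟩ := mem_iUnion₂.1 (ht hhxK)
  obtain ⟨⟨y, hy⟩, rfl, hb⟩ := h4 p ⟨x, hNi p hxp⟩ hxp y (hxy.trans_le (hδle p hpt))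
  obtain ⟨⟨z, hz⟩, rfl, -⟩ := h1 q ⟨h x, hNi q hxq⟩ hxq _ (hhxy.trans_le (hηle q hqt))
  exact h2 q ⟨h x, hNi q hxq⟩ ⟨h y, hz⟩ hxq
    ((h3 h hh (i p) (i q) x y _ _ hxs hys _ _ hb).trans_le (hε'le q hqt))

theorem IsStronglyEquicontinuous.exists_equicontinuousOnWith [MetricSpace Z] [LocallyCompactSpace Z]
    {H : StructureGroupoid Z} (hH : IsStronglyEquicontinuous H) {K : Set Z} (hK : IsCompact K) :
    ∃ S : Set (OpenPartialHomeomorph Z Z), IsSymmetric S ∧ IsClosedUnderComp S ∧ Generates S H ∧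
      OpenPartialHomeomorph.refl Z ∈ S ∧ ∃ η > 0, EquicontinuousOnWith S K η := by
  obtain ⟨Q, hQ, S, h1, h2, h3, h4⟩ := hH
  obtain ⟨η, hη, h5⟩ := Q.exists_equicontinuousOnWith hQ h4 hK
  refine ⟨_, h1.insert_refl, h2.insert_refl, h3.insert_refl, mem_insert _ _, η, hη, fun ε hε => ?_⟩
  obtain ⟨δ, hδ, h6⟩ := h5 ε hε
  -- The bound by `ε` takes care of the adjoined identity.
  refine ⟨min δ ε, lt_min hδ hε, ?_⟩
  rintro h (rfl | hh) x hx y hy hxK hhx hxy hhxy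
  · exact hxy.trans_le (min_le_right _ _)
  · exact h6 h hh x hx y hy hxK hhx (hxy.trans_le (min_le_left _ _)) hhxy

theorem IsQuasiEffective.exists_refl_mem [TopologicalSpace Z] {H : StructureGroupoid Z}
    (hH : IsQuasiEffective H) :
    ∃ S : Set (OpenPartialHomeomorph Z Z), IsSymmetric S ∧ IsClosedUnderComp S ∧ Generates S H ∧
      OpenPartialHomeomorph.refl Z ∈ S ∧
      ∀ h ∈ S, (∃ V : Set Z, IsOpen V ∧ V.Nonempty ∧ V ⊆ h.source ∧ ∀ x ∈ V, h x = x) →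
        ∀ x ∈ h.source, h x = x := by
  obtain ⟨S, h1, h2, h3, h4⟩ := hH
  refine ⟨_, h1.insert_refl, h2.insert_refl, h3.insert_refl, mem_insert _ _, ?_⟩
  rintro h (rfl | hh)
  · simp
  · exact h4 h hh

end QuasiLocalMetric

end LocalPseudogroup

namespace LocalPseudogroup

theorem exists_pos_forall_of_finite {ι : Type*} {s : Set ι} (hs : s.Finite) {P : ι → ℝ → Prop}
    (hmono : ∀ i a b, a ≤ b → P i b → P i a) (h : ∀ i ∈ s, ∃ δ > 0, P i δ) :
    ∃ δ > 0, ∀ i ∈ s, P i δ := by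
  have : ∀ᶠ δ in 𝓝[>] (0 : ℝ), ∀ i ∈ s, P i δ := by
    refine (Filter.eventually_all_finite hs).2 fun i hi => ?_
    obtain ⟨δ, hδ, hP⟩ := h i hi
    filter_upwards [Ioc_mem_nhdsGT hδ] with x hx using hmono i _ _ hx.2 hP
  obtain ⟨δ, h1, h2⟩ := (this.and self_mem_nhdsWithin).exists
  exact ⟨δ, h2, h1⟩

theorem exists_nat_forall_of_finite {ι : Type*} {s : Set ι} (hs : s.Finite) {P : ι → ℕ → Prop}
    (hmono : ∀ i a b, a ≤ b → P i a → P i b) (h : ∀ i ∈ s, ∃ n, P i n) : ∃ n, ∀ i ∈ s, P i n := by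
  have : ∀ᶠ n in Filter.atTop, ∀ i ∈ s, P i n := by
    refine (Filter.eventually_all_finite hs).2 fun i hi => ?_
    obtain ⟨n, hP⟩ := h i hi
    filter_upwards [Filter.eventually_ge_atTop n] with x hx using hmono i _ _ hx hP
  exact this.exists

/-! ### Local agreement with elements of a generating set closed under composition. -/

section AgreesOn

variable {X : Type u} [TopologicalSpace X]

/-- On the part `B` of its domain, `h` coincides with an element of `S`. -/
def AgreesOn (S : Set (OpenPartialHomeomorph X X)) (h : OpenPartialHomeomorph X X) (B : Set X) :
    Prop :=
  B ⊆ h.source ∧ ∃ s ∈ S, B ⊆ s.source ∧ EqOn h s B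

variable {S : Set (OpenPartialHomeomorph X X)} {h k : OpenPartialHomeomorph X X} {B C : Set X}

theorem AgreesOn.mono (H : AgreesOn S h B) (hC : C ⊆ B) : AgreesOn S h C := by
  obtain ⟨h1, s, hs, h2, h3⟩ := H
  exact ⟨hC.trans h1, s, hs, hC.trans h2, h3.mono hC⟩

theorem AgreesOn.trans (hS : IsClosedUnderComp S) (hh : AgreesOn S h B) (hk : AgreesOn S k C)
    (hm : MapsTo h B C) : AgreesOn S (h.trans k) B := by
  obtain ⟨h1, s, hs, h2, h3⟩ := hh
  obtain ⟨h1', s', hs', h2', h3'⟩ := hk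
  obtain ⟨s'', hs'', heq⟩ := hS s hs s' hs'
  have hsub : B ⊆ (s.trans s').source := fun x hx => by
    rw [OpenPartialHomeomorph.trans_source]
    exact ⟨h2 hx, by rw [mem_preimage, ← h3 hx]; exact h2' (hm hx)⟩
  refine ⟨fun x hx => ?_, s'', hs'', by rwa [heq.1], fun x hx => ?_⟩
  · rw [OpenPartialHomeomorph.trans_source]
    exact ⟨h1 hx, h1' (hm hx)⟩
  · rw [heq.2 (heq.1 ▸ hsub hx)]
    simp only [OpenPartialHomeomorph.coe_trans, Function.comp_apply]
    rw [h3' (hm hx), h3 hx]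

theorem AgreesOn.congr (H : AgreesOn S h B) (hB : B ⊆ k.source) (heq : EqOn k h B) :
    AgreesOn S k B := by
  obtain ⟨h1, s, hs, h2, h3⟩ := H
  exact ⟨hB, s, hs, h2, heq.trans h3⟩

theorem exists_eqOnSource_listComp (hS : IsClosedUnderComp S)
    (hid : OpenPartialHomeomorph.refl X ∈ S) {w : List (OpenPartialHomeomorph X X)}
    (hw : ∀ e ∈ w, e ∈ S) : ∃ s ∈ S, s.EqOnSource (listComp w) := by
  induction w with
  | nil => exact ⟨_, hid, OpenPartialHomeomorph.eqOnSource_refl _⟩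
  | cons g l ih =>
    obtain ⟨s, hs, h1⟩ := ih fun e he => hw e (by simp [he])
    obtain ⟨s', hs', h2⟩ := hS g (hw g (by simp)) s hs
    exact ⟨s', hs', Setoid.trans h2
      (OpenPartialHomeomorph.EqOnSource.trans' (OpenPartialHomeomorph.eqOnSource_refl g) h1)⟩

end AgreesOn

/-! ### Uniform extension of words. -/

section Metric

variable {Z : Type u} [MetricSpace Z] {H : StructureGroupoid Z}
  {S : Set (OpenPartialHomeomorph Z Z)}

/-- Near each point `h` is a word in `S`, which closure under composition collapses to a single
element of `S`; a Lebesgue number makes the radius uniform. -/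
theorem exists_agreesOn_ball (hs : IsSymmetric S) (hc : IsClosedUnderComp S) (hg : Generates S H)
    (hid : OpenPartialHomeomorph.refl Z ∈ S) {h : OpenPartialHomeomorph Z Z} (hh : h ∈ H)
    {C : Set Z} (hC : IsCompact C) (hCh : C ⊆ h.source) :
    ∃ ρ > 0, ∀ z ∈ C, AgreesOn S h (Metric.ball z ρ) := by
  have hloc : ∀ z : C, ∃ N, IsOpen N ∧ (z : Z) ∈ N ∧ AgreesOn S h N := by
    rintro ⟨z, hz⟩
    obtain ⟨w, hw, hwz, heq⟩ := hg.isWordAt hs hh (hCh hz)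
    obtain ⟨s, hsS, h1⟩ := exists_eqOnSource_listComp hc hid hw
    obtain ⟨N, hN, hNo, hzN⟩ := mem_nhds_iff.1 (Filter.inter_mem heq
      (Filter.inter_mem (h.open_source.mem_nhds (hCh hz)) ((listComp w).open_source.mem_nhds hwz)))
    refine ⟨N, hNo, hzN, fun x hx => (hN hx).2.1, s, hsS, fun x hx => ?_, fun x hx => ?_⟩
    · rw [h1.1]
      exact (hN hx).2.2
    · rw [h1.2 (by rw [h1.1]; exact (hN hx).2.2)]
      exact (hN hx).1
  choose N hNo hzN hN using hloc
  obtain ⟨ρ, hρ, h1⟩ := lebesgue_number_lemma_of_metric hC hNo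
    fun z hz => mem_iUnion.2 ⟨⟨z, hz⟩, hzN ⟨z, hz⟩⟩
  exact ⟨ρ, hρ, fun z hz => by
    obtain ⟨i, hi⟩ := h1 z hz
    exact (hN i).mono hi⟩

variable {U : Opens Z} {E : Set (OpenPartialHomeomorph U U)}
  {bar : OpenPartialHomeomorph U U → OpenPartialHomeomorph Z Z}

/-- `bar` extends the elements of `E` to elements of `H` defined around the closures of their
domains. -/
structure IsExtension (H : StructureGroupoid Z) (U : Opens Z)
    (E : Set (OpenPartialHomeomorph U U))
    (bar : OpenPartialHomeomorph U U → OpenPartialHomeomorph Z Z) : Prop where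
  mem : ∀ g ∈ E, bar g ∈ H
  closure_subset : ∀ g ∈ E, closure ((Subtype.val : U → Z) '' g.source) ⊆ (bar g).source
  eq : ∀ g ∈ E, ∀ x ∈ g.source, bar g (x : Z) = (g x : Z)

theorem IsExtension.listComp_mem (hb : IsExtension H U E bar)
    {w : List (OpenPartialHomeomorph U U)} (hw : ∀ e ∈ w, e ∈ E) : listComp (w.map bar) ∈ H := by
  refine LocalPseudogroup.listComp_mem fun e he => ?_
  obtain ⟨g, hg, rfl⟩ := List.mem_map.1 he
  exact hb.mem g (hw g hg)

theorem IsExtension.listComp_apply (hb : IsExtension H U E bar)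
    {w : List (OpenPartialHomeomorph U U)} (hw : ∀ e ∈ w, e ∈ E) {x : U}
    (hx : x ∈ (listComp w).source) :
    listComp (w.map bar) (x : Z) = (listComp w x : Z) := by
  induction w generalizing x with
  | nil => simp [listComp]
  | cons g l ih =>
    simp only [listComp, OpenPartialHomeomorph.trans_source, mem_inter_iff, mem_preimage] at hx
    simp only [listComp, List.map_cons, OpenPartialHomeomorph.coe_trans, Function.comp_apply]
    rw [hb.eq g (hw g (by simp)) x hx.1, ih (fun e he => hw e (by simp [he])) hx.2]

/-- The extensions of the composites of elements of `E` around a point are defined on the ball of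
radius `δ`, where they coincide with elements of `S`, and map that ball into a ball of radius `ε`. -/
def ExtendsUniformly (S : Set (OpenPartialHomeomorph Z Z)) (E : Set (OpenPartialHomeomorph U U))
    (bar : OpenPartialHomeomorph U U → OpenPartialHomeomorph Z Z) (δ ε : ℝ) : Prop :=
  ∀ w : List (OpenPartialHomeomorph U U), (∀ e ∈ w, e ∈ E) → ∀ x ∈ (listComp w).source,
    AgreesOn S (listComp (w.map bar)) (Metric.ball (x : Z) δ) ∧
      ∀ y ∈ Metric.ball (x : Z) δ, dist (listComp (w.map bar) y) (listComp w x : Z) < ε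

theorem IsExtension.exists_agreesOn_ball (hb : IsExtension H U E bar) (hE : E.Finite)
    (hU : IsCompact (closure (U : Set Z))) (hs : IsSymmetric S) (hc : IsClosedUnderComp S)
    (hg : Generates S H) (hid : OpenPartialHomeomorph.refl Z ∈ S) :
    ∃ ρ > 0, ∀ g ∈ E, ∀ z ∈ g.source, AgreesOn S (bar g) (Metric.ball (z : Z) ρ) := by
  refine exists_pos_forall_of_finite hE
    (fun g a b hab h z hz => (h z hz).mono (Metric.ball_subset_ball hab)) fun g hgE => ?_
  obtain ⟨ρ, hρ, h⟩ := LocalPseudogroup.exists_agreesOn_ball hs hc hg hid (hb.mem g hgE)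
    (hU.of_isClosed_subset isClosed_closure (closure_mono (by
      rintro _ ⟨x, -, rfl⟩
      exact x.2))) (hb.closure_subset g hgE)
  exact ⟨ρ, hρ, fun z hz => h z (subset_closure ⟨z, hz, rfl⟩)⟩

theorem IsExtension.exists_dist_lt (hb : IsExtension H U E bar) (hE : E.Finite)
    (hU : IsCompact (closure (U : Set Z))) {η : ℝ} (hη : 0 < η) :
    ∃ ρ > 0, ∀ g ∈ E, ∀ z ∈ g.source, ∀ y, dist (z : Z) y < ρ → dist (bar g z) (bar g y) < η := by
  refine exists_pos_forall_of_finite hE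
    (fun g a b hab h z hz y hy => h z hz y (hy.trans_le hab)) fun g hgE => ?_
  have hC : IsCompact (closure ((Subtype.val : U → Z) '' g.source)) :=
    hU.of_isClosed_subset isClosed_closure (closure_mono (by
      rintro _ ⟨x, -, rfl⟩
      exact x.2))
  obtain ⟨ρ, hρ, h⟩ := Metric.mem_uniformity_dist.1 (hC.uniformContinuousAt_of_continuousAt (bar g)
    (fun a ha => (bar g).continuousAt (hb.closure_subset g hgE ha)) (Metric.dist_mem_uniformity hη))
  exact ⟨ρ, hρ, fun z hz y hy => h hy (subset_closure ⟨z, hz, rfl⟩)⟩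

/-- Induction on words, the last letter being appended, with a radius that never shrinks. If the
extended word sends `B` into an `ε'`-ball, the next letter is defined there and agrees there with an
element of `S`, so the longer word agrees on all of `B` with one element of `S`. Equicontinuity then
restores the same bound `ε'`. The generators `S` supply equicontinuity; agreement with `S'` is
carried along for later use of quasi-effectiveness. -/
theorem IsExtension.exists_extendsUniformly (hb : IsExtension H U E bar) (hE : E.Finite)
    (hU : IsCompact (closure (U : Set Z)))
    (hs : IsSymmetric S) (hc : IsClosedUnderComp S)
    (hg : Generates S H) (hid : OpenPartialHomeomorph.refl Z ∈ S) {η : ℝ} (hη : 0 < η)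
    (heq : EquicontinuousOnWith S (closure (U : Set Z)) η)
    {S' : Set (OpenPartialHomeomorph Z Z)} (hs' : IsSymmetric S') (hc' : IsClosedUnderComp S')
    (hg' : Generates S' H) (hid' : OpenPartialHomeomorph.refl Z ∈ S') :
    ∀ ε > 0, ∃ δ > 0, ExtendsUniformly S' E bar δ ε := by
  obtain ⟨ρ₁, hρ₁, h1⟩ := hb.exists_agreesOn_ball hE hU hs hc hg hid
  obtain ⟨ρ₂, hρ₂, h2⟩ := hb.exists_agreesOn_ball hE hU hs' hc' hg' hid'
  obtain ⟨ρ₃, hρ₃, h3⟩ := hb.exists_dist_lt hE hU hη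
  intro ε hε
  obtain ⟨ε', hε', hεε', hρε₁, hρε₂, hρε₃⟩ : ∃ ε' > 0, ε' ≤ ε ∧ ε' ≤ ρ₁ ∧ ε' ≤ ρ₂ ∧ ε' ≤ ρ₃ :=
    ⟨min ε (min ρ₁ (min ρ₂ ρ₃)), by positivity, by simp, by simp, by simp, by simp⟩
  obtain ⟨δ, hδ, h4⟩ := heq ε' hε'
  refine ⟨min δ ε', lt_min hδ hε', ?_⟩
  suffices key : ∀ w : List (OpenPartialHomeomorph U U), (∀ e ∈ w, e ∈ E) →
      ∀ x ∈ (listComp w).source,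
      AgreesOn S (listComp (w.map bar)) (Metric.ball (x : Z) (min δ ε')) ∧
      AgreesOn S' (listComp (w.map bar)) (Metric.ball (x : Z) (min δ ε')) ∧
      ∀ y ∈ Metric.ball (x : Z) (min δ ε'),
        dist (listComp (w.map bar) y) (listComp w x : Z) < ε' from
    fun w hw x hx => ⟨(key w hw x hx).2.1, fun y hy => ((key w hw x hx).2.2 y hy).trans_le hεε'⟩
  intro w
  induction w using List.reverseRecOn with
  | nil =>
    intro _ x _
    refine ⟨⟨by simp [listComp], _, hid, by simp, fun y _ => rfl⟩,
      ⟨by simp [listComp], _, hid', by simp, fun y _ => rfl⟩, fun y hy => ?_⟩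
    simpa [listComp] using (Metric.mem_ball.1 hy).trans_le (min_le_right _ _)
  | append_singleton w g ih =>
    intro hw x hx
    have hgE : g ∈ E := hw g (by simp)
    rw [mem_source_listComp_append] at hx
    have hgx : listComp w x ∈ g.source := by simpa [listComp] using hx.2
    obtain ⟨i1, i2, i3⟩ := ih (fun e he => hw e (by simp [he])) x hx.1
    set B := Metric.ball (x : Z) (min δ ε') with hB
    have hxB : (x : Z) ∈ B := Metric.mem_ball_self (lt_min hδ hε')
    have hcomp : ∀ y, listComp ((w ++ [g]).map bar) y = bar g (listComp (w.map bar) y) := fun y => by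
      rw [List.map_append, listComp_append_apply]
      simp [listComp]
    have hsrc : ∀ y, y ∈ ((listComp (w.map bar)).trans (bar g)).source →
        y ∈ (listComp ((w ++ [g]).map bar)).source := fun y hy => by
      rw [List.map_append, mem_source_listComp_append]
      simpa [listComp] using hy
    have a1 := i1.trans hc (h1 g hgE _ hgx) fun y hy => (i3 y hy).trans_le hρε₁
    have a2 := i2.trans hc' (h2 g hgE _ hgx) fun y hy => (i3 y hy).trans_le hρε₂
    have a1' : AgreesOn S (listComp ((w ++ [g]).map bar)) B :=
      a1.congr (fun y hy => hsrc y (a1.1 hy)) fun y _ => hcomp y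
    have a2' : AgreesOn S' (listComp ((w ++ [g]).map bar)) B :=
      a2.congr (fun y hy => hsrc y (a2.1 hy)) fun y _ => hcomp y
    refine ⟨a1', a2', fun y hy => ?_⟩
    have hx' : x ∈ (listComp (w ++ [g])).source := by
      rw [mem_source_listComp_append]
      exact hx
    have e1 := hb.listComp_apply hw hx'
    obtain ⟨-, s, hsS, hsB, hsEq⟩ := a1'
    -- Uniform continuity of one letter gives the crude bound `η`, exactly what equicontinuity needs
    -- in order to improve it to `ε'` in `m2`.
    have m1 : dist (listComp ((w ++ [g]).map bar) x) (listComp ((w ++ [g]).map bar) y) < η := by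
      rw [hcomp, hcomp, hb.listComp_apply (fun e he => hw e (by simp [he])) hx.1]
      exact h3 g hgE _ hgx _ (by rw [dist_comm]; exact (i3 y hy).trans_le hρε₃)
    have m2 := h4 s hsS x (hsB hxB) y (hsB hy) (subset_closure x.2)
      (by rw [← hsEq hxB, e1]; exact subset_closure (Subtype.coe_prop _))
      (by rw [dist_comm]; exact (Metric.mem_ball.1 hy).trans_le (min_le_left _ _))
      (by rwa [← hsEq hxB, ← hsEq hy])
    rwa [← hsEq hxB, ← hsEq hy, e1, dist_comm] at m2

theorem exists_mem_restriction [ClosedUnderRestriction H] {h : OpenPartialHomeomorph Z Z}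
    (hh : h ∈ H) {x : U} (hx : (x : Z) ∈ h.source) (hhx : h x ∈ U) :
    ∃ e ∈ restriction H U, x ∈ e.source ∧ ∀ y ∈ e.source, (e y : Z) = h y := by
  let c := U.openPartialHomeomorphSubtypeCoe ⟨x⟩
  let k := (OpenPartialHomeomorph.refl Z).restr U
  have hks : ∀ z, z ∈ k.source ↔ z ∈ U := fun z => by
    simp [k, U.isOpen.interior_eq]
  have hcs : ∀ y, y ∈ c.source := fun y => by simp [c]
  have hct : ∀ z, z ∈ c.target ↔ z ∈ U := fun z => by simp [c]
  have hcc : ∀ y, c y = (y : Z) := fun y => rfl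
  have hcr : ∀ z, z ∈ U → (c.symm z : Z) = z := fun z hz => c.right_inv ((hct z).2 hz)
  have hmem : k.trans (h.trans k) ∈ H :=
    H.trans (closedUnderRestriction' H.id_mem U.isOpen)
      (H.trans hh (closedUnderRestriction' H.id_mem U.isOpen))
  have hes : ∀ y : U, y ∈ (c.trans (h.trans c.symm)).source ↔ (y : Z) ∈ h.source ∧ h y ∈ U := by
    intro y
    simp only [OpenPartialHomeomorph.trans_source, OpenPartialHomeomorph.symm_source, mem_inter_iff,
      mem_preimage, hcs, hct, hcc, true_and]
  have hev : ∀ y ∈ (c.trans (h.trans c.symm)).source, ((c.trans (h.trans c.symm)) y : Z) = h y :=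
    fun y hy => hcr _ ((hes y).1 hy).2
  refine ⟨c.trans (h.trans c.symm), H.mem_of_eqOnSource hmem ⟨?_, ?_⟩, (hes x).2 ⟨hx, hhx⟩, hev⟩
  · ext z
    rw [extendOpen_source]
    simp only [OpenPartialHomeomorph.trans_source k, OpenPartialHomeomorph.trans_source h k,
      mem_inter_iff, mem_preimage, hks, mem_image, hes]
    constructor
    · rintro ⟨y, hy, rfl⟩
      exact ⟨y.2, hy⟩
    · rintro ⟨hz, hy⟩
      exact ⟨⟨z, hz⟩, hy, rfl⟩
  · rintro _ ⟨y, hy, rfl⟩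
    rw [extendOpen_coe, hev y hy]
    rfl

theorem HasTrivialGermGroup.eventually_eq [ClosedUnderRestriction H] {x : U}
    (hx : HasTrivialGermGroup (restriction H U) x)
    {h : OpenPartialHomeomorph Z Z} (hh : h ∈ H) (hxs : (x : Z) ∈ h.source) (hhx : h x = x) :
    ∀ᶠ y in 𝓝 (x : Z), h y = y := by
  obtain ⟨e, he, hxe, heq⟩ := exists_mem_restriction hh hxs (by rw [hhx]; exact x.2)
  have h1 := hx e he hxe (Subtype.ext (by rw [heq x hxe, hhx]))
  rw [← U.isOpen.isOpenEmbedding_subtypeVal.map_nhds_eq, Filter.eventually_map]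
  filter_upwards [h1, e.open_source.mem_nhds hxe] with y h2 h3
  rw [← heq y h3, h2]

/-- The word representing the germ at `z` still represents `h` at nearby points, so its length works
for them too. -/
theorem exists_reach_of_mem [ClosedUnderRestriction H] (hs : IsSymmetric E)
    (hg : Generates E (restriction H U)) {h : OpenPartialHomeomorph Z Z}
    (hh : h ∈ H) {z : Z} (hz : z ∈ U) (hzs : z ∈ h.source) (hhz : h z ∈ U) :
    ∃ n, ∃ O, IsOpen O ∧ z ∈ O ∧ ∀ v b : U, (v : Z) ∈ O → h v = b → Reach E n v b := by
  obtain ⟨e, he, hxe, heq⟩ := exists_mem_restriction (x := ⟨z, hz⟩) hh hzs hhz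
  obtain ⟨w, hw, hwx, hwe⟩ := hg.isWordAt hs he hxe
  obtain ⟨O, hO, hOo, hzO⟩ := mem_nhds_iff.1 (Filter.inter_mem hwe
    (Filter.inter_mem (e.open_source.mem_nhds hxe) ((listComp w).open_source.mem_nhds hwx)))
  refine ⟨w.length, Subtype.val '' O, U.isOpen.isOpenMap_subtype_val _ hOo, ⟨_, hzO, rfl⟩, ?_⟩
  rintro v b ⟨v', hv', hvv⟩ hb
  obtain rfl := Subtype.ext hvv
  obtain ⟨h1, h2, h3⟩ := hO hv'
  exact ⟨w, le_rfl, hw, h3, Subtype.ext (by rw [← hb, ← heq _ h2]; exact congrArg _ h1.symm)⟩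

/-- The extended word may pass outside `U` at `v'`, so it must be respelled in `E`. For fixed `w`,
the points `v` concerned form a set whose closure lies in `K`, as does its image; each point of this
closure has a neighbourhood on which a respelling of bounded length exists. Compactness, and
finiteness of the set of words of length at most `L`, give `N` and `r`. -/
theorem IsExtension.exists_reach_bound [ClosedUnderRestriction H] (hb : IsExtension H U E bar)
    (hE : E.Finite) (hs : IsSymmetric E) (hg : Generates E (restriction H U)) {δ ε : ℝ} (hδ : 0 < δ)
    (hext : ExtendsUniformly S E bar δ ε) {K : Set Z} (hK : IsCompact K) (hKU : K ⊆ U) (L : ℕ) :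
    ∃ N : ℕ, ∃ r > 0, ∀ w : List (OpenPartialHomeomorph U U), (∀ e ∈ w, e ∈ E) → w.length ≤ L →
      ∀ v ∈ (listComp w).source, (v : Z) ∈ K → (listComp w v : Z) ∈ K →
        ∀ v' b : U, dist (v : Z) v' < r → listComp (w.map bar) v' = b → Reach E N v' b := by
  have hfin : {w : List (OpenPartialHomeomorph U U) | (∀ e ∈ w, e ∈ E) ∧ w.length ≤ L}.Finite := by
    have : Finite E := hE
    refine ((List.finite_length_le E L).image (List.map Subtype.val)).subset ?_
    rintro w ⟨hw, hl⟩
    lift w to List E using hw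
    exact ⟨w, by simpa using hl, rfl⟩
  suffices h : ∃ N : ℕ, ∀ w ∈ {w : List (OpenPartialHomeomorph U U) |
      (∀ e ∈ w, e ∈ E) ∧ w.length ≤ L}, ∃ r > 0,
      ∀ v ∈ (listComp w).source, (v : Z) ∈ K → (listComp w v : Z) ∈ K →
        ∀ v' b : U, dist (v : Z) v' < r → listComp (w.map bar) v' = b → Reach E N v' b by
    obtain ⟨N, hN⟩ := h
    obtain ⟨r, hr, h⟩ := exists_pos_forall_of_finite hfin
      (fun w a b hab h v hv hvK hwK v' b hvv => h v hv hvK hwK v' b (hvv.trans_le hab)) hN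
    exact ⟨N, r, hr, fun w hw hl => h w ⟨hw, hl⟩⟩
  refine exists_nat_forall_of_finite hfin ?_ ?_
  · rintro w m n hmn ⟨r, hr, h⟩
    exact ⟨r, hr, fun v hv hvK hwK v' b hvv hb => (h v hv hvK hwK v' b hvv hb).mono hmn⟩
  rintro w ⟨hw, -⟩
  set D : Set Z := Subtype.val '' {v : U | v ∈ (listComp w).source ∧ (v : Z) ∈ K ∧
    (listComp w v : Z) ∈ K} with hD
  have hDK : closure D ⊆ K := closure_minimal (by rintro _ ⟨v, hv, rfl⟩; exact hv.2.1) hK.isClosed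
  -- The word itself may be undefined at a limit point of `D`, but its extension is defined on
  -- `δ`-balls around points of `D`.
  have hDs : closure D ⊆ (listComp (w.map bar)).source := by
    intro z hz
    obtain ⟨_, ⟨v, hv, rfl⟩, hzv⟩ := Metric.mem_closure_iff.1 hz δ hδ
    exact (hext w hw v hv.1).1.1 hzv
  have hDm : ∀ z ∈ closure D, listComp (w.map bar) z ∈ K := fun z hz => by
    have := ((listComp (w.map bar)).continuousAt (hDs hz)).continuousWithinAt (s := D)
      |>.mem_closure hz (t := K) (by
        rintro _ ⟨v, hv, rfl⟩
        rw [hb.listComp_apply hw hv.1]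
        exact hv.2.2)
    rwa [hK.isClosed.closure_eq] at this
  obtain ⟨N, O, hO, hDO, h⟩ : ∃ N, ∃ O, IsOpen O ∧ closure D ⊆ O ∧ ∀ v b : U, (v : Z) ∈ O →
      listComp (w.map bar) v = b → Reach E N v b := by
    refine (hK.of_isClosed_subset isClosed_closure hDK).induction_on ?_ ?_ ?_ ?_
    · exact ⟨0, ∅, isOpen_empty, subset_rfl, fun v b h => h.elim⟩
    · rintro s t hst ⟨N, O, hO, h1, h2⟩
      exact ⟨N, O, hO, hst.trans h1, h2⟩
    · rintro s t ⟨N, O, hO, h1, h2⟩ ⟨N', O', hO', h1', h2'⟩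
      refine ⟨max N N', O ∪ O', hO.union hO', union_subset_union h1 h1', ?_⟩
      rintro v b (hv | hv) hvb
      exacts [(h2 v b hv hvb).mono (le_max_left _ _), (h2' v b hv hvb).mono (le_max_right _ _)]
    · intro z hz
      obtain ⟨n, O, hO, hzO, h1⟩ := exists_reach_of_mem hs hg (hb.listComp_mem hw) (hKU (hDK hz))
        (hDs hz) (hKU (hDm z hz))
      exact ⟨O, mem_nhdsWithin_of_mem_nhds (hO.mem_nhds hzO), n, O, hO, subset_rfl, h1⟩
  obtain ⟨r, hr, hrO⟩ := (hK.of_isClosed_subset isClosed_closure hDK).exists_thickening_subset_open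
    hO hDO
  refine ⟨N, r, hr, fun v hv hvK hwK v' b hvv => h v' b (hrO (Metric.mem_thickening_iff.2
    ⟨v, subset_closure ⟨v, ⟨hv, hvK, hwK⟩, rfl⟩, by rwa [dist_comm]⟩))⟩

end Metric

end LocalPseudogroup

namespace LocalPseudogroup

/-! ### Transport between nearby orbits. -/

section Transport

variable {Z : Type u} [MetricSpace Z] {H : StructureGroupoid Z}
  {S : Set (OpenPartialHomeomorph Z Z)} {U : Opens Z} {E : Set (OpenPartialHomeomorph U U)}
  {bar : OpenPartialHomeomorph U U → OpenPartialHomeomorph Z Z}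

/-- Some element of `H` that is defined on `B`, coincides there with an element of `S`, and has a
small image, maps `x` to `a` and `x'` to `b`. -/
def Transport (H : StructureGroupoid Z) (S : Set (OpenPartialHomeomorph Z Z)) (K B : Set Z) (ε : ℝ)
    (x x' a b : U) : Prop :=
  (a : Z) ∈ K ∧ (b : Z) ∈ K ∧ ∃ h ∈ H, AgreesOn S h B ∧ h x = a ∧ h x' = b ∧
    ∀ y ∈ B, dist (h y) a < ε ∧ dist (h y) b < ε

theorem Transport.symm {K B : Set Z} {ε : ℝ} {x x' a b : U} (h : Transport H S K B ε x x' a b) :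
    Transport H S K B ε x' x b a := by
  obtain ⟨h1, h2, k, hk, h3, h4, h5, h6⟩ := h
  exact ⟨h2, h1, k, hk, h3, h5, h4, fun y hy => (h6 y hy).symm⟩

variable [ClosedUnderRestriction H]

theorem mem_orbit_restriction {h : OpenPartialHomeomorph Z Z} (hh : h ∈ H) {x a : U}
    (hx : (x : Z) ∈ h.source) (ha : h x = a) : a ∈ orbit (restriction H U) x := by
  obtain ⟨e, he, hxe, heq⟩ := exists_mem_restriction hh hx (by rw [ha]; exact a.2)
  exact ⟨e, he, hxe, Subtype.ext (by rw [heq x hxe, ha])⟩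

theorem exists_word_of_mem_orbit {X : Type u} [TopologicalSpace X] {G : StructureGroupoid X}
    {E : Set (OpenPartialHomeomorph X X)} (hs : IsSymmetric E) (hg : Generates E G) {x y : X}
    (h : y ∈ orbit G x) : ∃ w : List (OpenPartialHomeomorph X X), (∀ e ∈ w, e ∈ E) ∧
      x ∈ (listComp w).source ∧ listComp w x = y := by
  obtain ⟨k, hk, hx, rfl⟩ := h
  obtain ⟨w, hw, hwx, heq⟩ := hg.isWordAt hs hk hx
  exact ⟨w, hw, hwx, heq.self_of_nhds.symm⟩

/-- The elements of `S` that are the identity on a non-empty open set are identities. -/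
def IsQuasiEffectiveSet (S : Set (OpenPartialHomeomorph Z Z)) : Prop :=
  ∀ h ∈ S, (∃ V : Set Z, IsOpen V ∧ V.Nonempty ∧ V ⊆ h.source ∧ ∀ x ∈ V, h x = x) →
    ∀ x ∈ h.source, h x = x

/-- Choose a word leading from `a` back to `x`. Followed by its extension, `h` fixes `x`, so it is
the identity near `x` by triviality of germs, and on all of `B` by quasi-effectiveness, as it agrees
there with one element of `S`. The same holds for `h'`, and the extended word is injective. -/
theorem eqOn_of_agreesOn (hq : IsQuasiEffectiveSet S) (hc : IsClosedUnderComp S)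
    (hb : IsExtension H U E bar) (hs : IsSymmetric E) (hg : Generates E (restriction H U))
    {δ ε : ℝ} (hext : ExtendsUniformly S E bar δ ε) {B : Set Z} (hB : IsOpen B) {x a : U}
    (hx : HasTrivialGermGroup (restriction H U) x) (hxB : (x : Z) ∈ B)
    {h h' : OpenPartialHomeomorph Z Z} (hh : h ∈ H) (hh' : h' ∈ H) (hhB : AgreesOn S h B)
    (hhB' : AgreesOn S h' B) (hxa : h x = a) (hxa' : h' x = a)
    (hm : MapsTo h B (Metric.ball (a : Z) δ)) (hm' : MapsTo h' B (Metric.ball (a : Z) δ)) :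
    EqOn h h' B := by
  obtain ⟨w, hw, haw, hwa⟩ := exists_word_of_mem_orbit hs hg
    ((orbitSetoid (restriction H U)).symm (mem_orbit_restriction hh (hhB.1 hxB) hxa))
  have hwb : listComp (w.map bar) (a : Z) = x := by rw [hb.listComp_apply hw haw, hwa]
  have key : ∀ k ∈ H, AgreesOn S k B → k x = a → MapsTo k B (Metric.ball (a : Z) δ) → ∀ y ∈ B,
      listComp (w.map bar) (k y) = y := by
    intro k hk hkB hka hkm y hy
    have h1 := hkB.trans hc (hext w hw a haw).1 hkm
    have h2 := hx.eventually_eq (H.trans hk (hb.listComp_mem hw)) (h1.1 hxB) (by simp [hka, hwb])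
    obtain ⟨-, s, hsS, hsB, hsEq⟩ := h1
    obtain ⟨V, hV, hVo, hxV⟩ := mem_nhds_iff.1 (Filter.inter_mem h2 (hB.mem_nhds hxB))
    have h3 := hq s hsS ⟨V, hVo, ⟨x, hxV⟩, fun z hz => hsB (hV hz).2, fun z hz => by
      rw [← hsEq (hV hz).2]
      exact (hV hz).1⟩ y (hsB hy)
    rw [← hsEq hy] at h3
    exact h3
  intro y hy
  have hsrc := (hext w hw a haw).1.1
  exact (listComp (w.map bar)).injOn (hsrc (hm hy)) (hsrc (hm' hy))
    ((key h hh hhB hxa hm y hy).trans (key h' hh' hhB' hxa' hm' y hy).symm)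

theorem Transport.mem_orbit {K B : Set Z} {ε : ℝ} {x x' a b : U} (h : Transport H S K B ε x x' a b)
    (hx : (x : Z) ∈ B) : a ∈ orbit (restriction H U) x := by
  obtain ⟨-, -, k, hk, h3, h4, -, -⟩ := h
  exact mem_orbit_restriction hk (h3.1 hx) h4

/-- The elements of a uniform net in each orbit can be transported to nearby orbits. -/
theorem exists_transport (hb : IsExtension H U E bar) (hs : IsSymmetric E)
    (hg : Generates E (restriction H U)) {δ ε r : ℝ}
    (hext : ExtendsUniformly S E bar δ (ε / 2)) (hεr : ε ≤ r) {V : Set U} {K B : Set Z}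
    (hVK : Metric.thickening r ((Subtype.val : U → Z) '' V) ⊆ K) (hKU : K ⊆ U) {n : ℕ}
    (hV : ∀ u : U, ∃ v ∈ V, Reach E n u v) {x x' u : U} (hx : (x : Z) ∈ B) (hx' : (x' : Z) ∈ B)
    (hB : B ⊆ Metric.ball (x : Z) δ) (hu : u ∈ orbit (restriction H U) x) :
    ∃ a b, Reach E n u a ∧ Transport H S K B ε x x' a b := by
  obtain ⟨a, haV, hua⟩ := hV u
  have ha : a ∈ orbit (restriction H U) x :=
    (orbitSetoid (restriction H U)).trans hu (hua.mem_orbit hg)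
  obtain ⟨w, hw, hwx, hwa⟩ := exists_word_of_mem_orbit hs hg ha
  obtain ⟨h1, h2⟩ := hext w hw x hwx
  rw [hwa] at h2
  have hε : 0 < ε := by
    have := dist_nonneg.trans_lt (h2 x (hB hx))
    linarith
  have hthick : ∀ z, dist z (a : Z) < ε → z ∈ K := fun z hz =>
    hVK (Metric.mem_thickening_iff.2 ⟨a, ⟨a, haV, rfl⟩, hz.trans_le hεr⟩)
  have hbK : listComp (w.map bar) x' ∈ K := hthick _ ((h2 x' (hB hx')).trans (half_lt_self hε))
  refine ⟨a, ⟨_, hKU hbK⟩, hua, hthick _ (by simpa using hε), hbK, listComp (w.map bar),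
    hb.listComp_mem hw, h1.mono hB, by rw [hb.listComp_apply hw hwx, hwa], rfl,
    fun y hy => ⟨(h2 y (hB hy)).trans (half_lt_self hε), ?_⟩⟩
  -- The radius `ε / 2` around `a` becomes `ε` around `b`; this keeps the relation symmetric in the
  -- two orbits.
  calc dist (listComp (w.map bar) y) (listComp (w.map bar) x')
      ≤ dist (listComp (w.map bar) y) a + dist (listComp (w.map bar) x') a :=
        dist_triangle_right _ _ _
    _ < ε := by linarith [h2 y (hB hy), h2 x' (hB hx')]

/-- If `w` leads from `a` to `a'`, then `h` followed by the extension of `w` and `h'` both send `x`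
to `a'`. They therefore agree at `x'`, so the extension of `w` sends `b` to `b'`, and `hN` respells
it. -/
theorem Transport.reach (hq : IsQuasiEffectiveSet S) (hc : IsClosedUnderComp S)
    (hb : IsExtension H U E bar) (hs : IsSymmetric E) (hg : Generates E (restriction H U))
    {δ δ' ε ε' r : ℝ} (hext : ExtendsUniformly S E bar δ ε')
    (hext' : ExtendsUniformly S E bar δ' δ) (hεδ : ε ≤ δ) (hεδ' : ε ≤ δ') (hεr : ε ≤ r)
    {K B : Set Z} (hB : IsOpen B) {L N : ℕ}
    (hN : ∀ w : List (OpenPartialHomeomorph U U), (∀ e ∈ w, e ∈ E) → w.length ≤ L →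
      ∀ v ∈ (listComp w).source, (v : Z) ∈ K → (listComp w v : Z) ∈ K →
        ∀ v' b : U, dist (v : Z) v' < r → listComp (w.map bar) v' = b → Reach E N v' b)
    {x x' a b a' b' : U} (hx : (x : Z) ∈ B) (hx' : (x' : Z) ∈ B)
    (htriv : HasTrivialGermGroup (restriction H U) x) (h : Transport H S K B ε x x' a b)
    (h' : Transport H S K B ε x x' a' b') (hr : Reach E L a a') : Reach E N b b' := by
  obtain ⟨haK, -, h, hh, hhB, hxa, hxb, hd⟩ := h
  obtain ⟨haK', -, h', hh', hhB', hxa', hxb', hd'⟩ := h'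
  obtain ⟨w, hl, hw, hwa, rfl⟩ := hr
  obtain ⟨h1, h2⟩ := hext' w hw a hwa
  have hm : MapsTo h B (Metric.ball (a : Z) δ') := fun y hy => (hd y hy).1.trans_le hεδ'
  have h3 := eqOn_of_agreesOn hq hc hb hs hg hext hB htriv hx
    (H.trans hh (hb.listComp_mem hw)) hh' (hhB.trans hc h1 hm) hhB'
    (by simp [hxa, hb.listComp_apply hw hwa]) hxa' (fun y hy => h2 _ (hm hy))
    (fun y hy => (hd' y hy).1.trans_le hεδ) hx'
  simp only [OpenPartialHomeomorph.coe_trans, Function.comp_apply, hxb, hxb'] at h3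
  refine hN w hw hl a hwa haK haK' b b' ?_ h3
  have := (hd x hx).2
  rw [hxa] at this
  exact this.trans_le hεr

/-- Along the word, `c` is the net point attached to the current point `u`. Consecutive net points
are at distance at most `n + 1 + n`, so each letter costs `N`; the last `N` compares with the
prescribed `b'`. -/
theorem reach_of_chain {X : Type u} [TopologicalSpace X] {G : StructureGroupoid X}
    {E : Set (OpenPartialHomeomorph X X)} (hs : IsSymmetric E) (hg : Generates E G)
    {R : X → X → Prop} {x : X} {n N : ℕ}
    (hR : ∀ u ∈ orbit G x, ∃ a b, Reach E n u a ∧ R a b)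
    (hN : ∀ a b a' b', R a b → R a' b' → Reach E (2 * n + 1) a a' → Reach E N b b')
    {w : List (OpenPartialHomeomorph X X)} (hw : ∀ e ∈ w, e ∈ E) {u c b b' : X}
    (hu : u ∈ orbit G x) (huw : u ∈ (listComp w).source) (hcu : Reach E n c u) (hcb : R c b)
    (hb' : R (listComp w u) b') : Reach E (N * w.length + N) b b' := by
  induction w generalizing u c b with
  | nil => simpa using hN _ _ _ _ hcb hb' (hcu.mono (by omega))
  | cons g l ih =>
    simp only [listComp, OpenPartialHomeomorph.trans_source, mem_inter_iff, mem_preimage] at huw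
    have hgE := hw g (by simp)
    have hgu : g u ∈ orbit G x :=
      (orbitSetoid G).trans hu ⟨g, hg.1 g hgE, huw.1, rfl⟩
    obtain ⟨c₁, b₁, h1, h2⟩ := hR _ hgu
    have h3 := hN _ _ _ _ hcb h2 (((hcu.trans (reach_one hgE huw.1)).trans h1).mono (by omega))
    have h4 := ih (fun e he => hw e (by simp [he])) hgu huw.2 (h1.symm hs) h2 hb'
    exact (h3.trans h4).mono (by simp only [List.length_cons]; linarith)

theorem coarselyCorrespond_of_relation {X : Type u} [TopologicalSpace X] {G : StructureGroupoid X}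
    {E : Set (OpenPartialHomeomorph X X)} (hs : IsSymmetric E) (hg : Generates E G)
    {R : X → X → Prop} {x x' : X} {n N : ℕ} (h0 : ∀ a b, R a b → a ∈ orbit G x ∧ b ∈ orbit G x')
    (hR : ∀ u ∈ orbit G x, ∃ a b, Reach E n u a ∧ R a b)
    (hR' : ∀ u ∈ orbit G x', ∃ a b, Reach E n u b ∧ R a b)
    (hN : ∀ a b a' b', R a b → R a' b' → Reach E (2 * n + 1) a a' → Reach E N b b')
    (hN' : ∀ a b a' b', R a b → R a' b' → Reach E (2 * n + 1) b b' → Reach E N a a') :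
    CoarselyCorrespond (orbitDist G E) (n + N) (orbit G x) (orbit G x') := by
  have hmem : ∀ {x y z}, y ∈ orbit G x → z ∈ orbit G x → z ∈ orbit G y := fun hy hz => by
    rwa [orbit_eq_of_mem hy]
  have main : ∀ {R : X → X → Prop} {x x' : X}, (∀ a b, R a b → a ∈ orbit G x ∧ b ∈ orbit G x') →
      (∀ u ∈ orbit G x, ∃ a b, Reach E n u a ∧ R a b) →
      (∀ a b a' b', R a b → R a' b' → Reach E (2 * n + 1) a a' → Reach E N b b') →
      ∀ a b a' b', R a b → R a' b' →
        orbitDist G E b b' ≤ (n + N) * orbitDist G E a a' + (n + N) := by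
    intro R x x' h0 hR hN a b a' b' h h'
    obtain ⟨w, hl, hw, hwa, rfl⟩ :=
      (orbitDist_le_iff hs hg (hmem (h0 _ _ h).1 (h0 _ _ h').1)).1 le_rfl
    rw [orbitDist_le_iff hs hg (hmem (h0 _ _ h).2 (h0 _ _ h').2)]
    refine (reach_of_chain hs hg hR hN hw (h0 _ _ h).1 hwa (Reach.refl n a) h h').mono ?_
    gcongr <;> omega
  refine ⟨R, h0, fun u hu => ?_, fun u hu => ?_, main h0 hR hN, ?_⟩
  · obtain ⟨a, b, h1, h2⟩ := hR u hu
    exact ⟨a, b, (orbitDist_le_iff hs hg (h1.mem_orbit hg)).2 (h1.mono (by omega)), h2⟩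
  · obtain ⟨a, b, h1, h2⟩ := hR' u hu
    exact ⟨a, b, (orbitDist_le_iff hs hg (h1.mem_orbit hg)).2 (h1.mono (by omega)), h2⟩
  · intro a b a' b' h h'
    exact main (R := fun a b => R b a) (fun a b h => (h0 b a h).symm)
      (fun u hu => by obtain ⟨a, b, h1, h2⟩ := hR' u hu; exact ⟨b, a, h1, h2⟩)
      (fun a b a' b' h h' => hN' b a b' a' h h') b a b' a' h h'

/-- Nearby orbits with trivial group of germs correspond, with uniform constants. -/
theorem exists_coarselyCorrespond_of_dist_lt [LocallyCompactSpace Z]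
    (hse : IsStronglyEquicontinuous H) (hqe : IsQuasiEffective H)
    (hUc : IsCompact (closure (U : Set Z))) (hE : IsSystemOfCompactGeneration H U E)
    {V : Set U} (hVc : IsCompact (closure V)) {n : ℕ} (hV : ∀ u : U, ∃ v ∈ V, Reach E n u v) :
    ∃ C : ℕ, ∃ r > 0, ∀ x x' : U, HasTrivialGermGroup (restriction H U) x →
      HasTrivialGermGroup (restriction H U) x' → dist (x : Z) x' < r →
      CoarselyCorrespond (orbitDist (restriction H U) E) C (orbit (restriction H U) x)
        (orbit (restriction H U) x') := by
  obtain ⟨hfin, hs, hg, hbar⟩ := hE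
  have : Nonempty (OpenPartialHomeomorph Z Z) := ⟨OpenPartialHomeomorph.refl Z⟩
  choose! bar hbar using hbar
  have hb : IsExtension H U E bar :=
    ⟨fun g hg => (hbar g hg).1, fun g hg => (hbar g hg).2.1, fun g hg => (hbar g hg).2.2⟩
  obtain ⟨S, hSs, hSc, hSg, hSid, η, hη, heq⟩ := hse.exists_equicontinuousOnWith hUc
  obtain ⟨S', hSs', hSc', hSg', hSid', hq⟩ := hqe.exists_refl_mem
  have hext := hb.exists_extendsUniformly hfin hUc hSs hSc hSg hSid hη heq hSs' hSc' hSg' hSid'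
  have hK₁ : IsCompact ((Subtype.val : U → Z) '' closure V) := hVc.image continuous_subtype_val
  -- A margin around the closure of `V` inside `U`: the copy of a point of `V` in the other orbit is
  -- only near `V`, but stays in `K`.
  obtain ⟨K, hK, hK₁K, hKU⟩ := exists_compact_between hK₁ U.isOpen (by
    rintro _ ⟨v, -, rfl⟩
    exact v.2)
  obtain ⟨r₁, hr₁, hthick⟩ := hK₁.exists_thickening_subset_open isOpen_interior hK₁K
  have hVK : Metric.thickening r₁ ((Subtype.val : U → Z) '' V) ⊆ K :=
    (Metric.thickening_subset_of_subset _ (image_mono subset_closure)).trans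
      (hthick.trans interior_subset)
  -- Only the domain of the extensions matters for `δ₀`, not the size 1 of the images. The radius
  -- `δ₁` makes words send `δ₁`-balls into `δ₀`-balls, so that compositions of transports with words
  -- remain controlled.
  obtain ⟨δ₀, hδ₀, hext₀⟩ := hext 1 one_pos
  obtain ⟨N, r₂, hr₂, hN⟩ := hb.exists_reach_bound hfin hs hg hδ₀ hext₀ hK hKU (2 * n + 1)
  obtain ⟨δ₁, hδ₁, hext₁⟩ := hext δ₀ hδ₀
  obtain ⟨ε, hε, hε₁, hε₂, hε₃, hε₄⟩ : ∃ ε > 0, ε ≤ r₁ ∧ ε ≤ r₂ ∧ ε ≤ δ₀ ∧ ε ≤ δ₁ :=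
    ⟨min r₁ (min r₂ (min δ₀ δ₁)), by positivity, by simp, by simp, by simp, by simp⟩
  obtain ⟨δ, hδ, hext₂⟩ := hext (ε / 2) (half_pos hε)
  refine ⟨n + N, δ / 2, half_pos hδ, fun x x' hx hx' hxx' => ?_⟩
  -- Half the radius, so that `B` lies in the `δ`-balls around both `x` and `x'`.
  let B := Metric.ball (x : Z) (δ / 2)
  have hxB : (x : Z) ∈ B := Metric.mem_ball_self (half_pos hδ)
  have hxB' : (x' : Z) ∈ B := by
    rw [Metric.mem_ball, dist_comm]
    exact hxx'
  have hB : B ⊆ Metric.ball (x : Z) δ := Metric.ball_subset_ball (by linarith)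
  have hB' : B ⊆ Metric.ball (x' : Z) δ := Metric.ball_subset_ball' (by linarith)
  refine coarselyCorrespond_of_relation hs hg (R := Transport H S' K B ε x x')
    (fun a b h => ⟨h.mem_orbit hxB, h.symm.mem_orbit hxB'⟩)
    (fun u hu => exists_transport hb hs hg hext₂ hε₁ hVK hKU hV hxB hxB' hB hu)
    (fun u hu => ?_)
    (fun a b a' b' h h' hr => h.reach hq hSc' hb hs hg hext₀ hext₁ hε₃ hε₄ hε₂
      Metric.isOpen_ball hN hxB hxB' hx h' hr)
    (fun a b a' b' h h' hr => h.symm.reach hq hSc' hb hs hg hext₀ hext₁ hε₃ hε₄ hε₂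
      Metric.isOpen_ball hN hxB' hxB hx' h'.symm hr)
  obtain ⟨b, a, h1, h2⟩ := exists_transport hb hs hg hext₂ hε₁ hVK hKU hV hxB' hxB hB' hu
  exact ⟨a, b, h1, h2.symm⟩

end Transport

/-! ### Propagation through the connected orbit space. -/

section Connected

/-- If the orbit space is connected, then a non-empty set of `U` which is open, invariant by the
restriction to `U`, and whose complement is open, is the whole of `U`. -/
theorem eq_univ_of_isClopen_of_invariant {Z : Type u} [TopologicalSpace Z]
    {H : StructureGroupoid Z} (hconn : PreconnectedSpace (OrbitSpace H)) {U : Opens Z}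
    (hU : MeetsEveryOrbit H (U : Set Z)) {A : Set U} (hA : IsClopen A) (hne : A.Nonempty)
    (hinv : ∀ x ∈ A, ∀ y : U, (y : Z) ∈ orbit H (x : Z) → y ∈ A) : A = univ := by
  let π : U → OrbitSpace H := fun u => Quotient.mk (orbitSetoid H) (u : Z)
  have hπ : ∀ u v : U, π u = π v → (v : Z) ∈ orbit H (u : Z) := fun u v h => Quotient.exact h
  -- The saturation of an open set is open, because elements of `H` are homeomorphisms between open
  -- sets.
  have hopen : ∀ B : Set U, IsOpen B → IsOpen (π '' B) := by
    intro B hB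
    refine isQuotientMap_quotient_mk'.isOpen_preimage.1 (isOpen_iff_mem_nhds.2 ?_)
    rintro z ⟨u, hu, huz⟩
    obtain ⟨h, hh, hz, hzu⟩ : (u : Z) ∈ orbit H z := Quotient.exact huz.symm
    have h1 : IsOpen ((Subtype.val : U → Z) '' B) := U.isOpen.isOpenMap_subtype_val _ hB
    filter_upwards [h.open_source.mem_nhds hz, h.continuousAt hz |>.preimage_mem_nhds
      (h1.mem_nhds (by rw [hzu]; exact ⟨u, hu, rfl⟩))] with y hy hy'
    obtain ⟨v, hv, hvy⟩ := hy'
    exact ⟨v, hv, Quotient.sound ((orbitSetoid H).symm ⟨h, hh, hy, hvy.symm⟩)⟩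
  -- Since `U` meets every orbit, the two images cover the orbit space; since `A` is invariant, they
  -- are disjoint.
  have hcompl : (π '' A)ᶜ = π '' Aᶜ := by
    ext c
    constructor
    · intro hc
      obtain ⟨z, rfl⟩ := Quotient.exists_rep c
      obtain ⟨u, huz, huU⟩ := hU z
      have hzu : π ⟨u, huU⟩ = Quotient.mk (orbitSetoid H) z :=
        Quotient.sound ((orbitSetoid H).symm huz)
      exact ⟨⟨u, huU⟩, fun hu => hc ⟨_, hu, hzu⟩, hzu⟩
    · rintro ⟨u, hu, rfl⟩ ⟨v, hv, hvu⟩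
      exact hu (hinv v hv u (hπ v u hvu))
  have hclopen : IsClopen (π '' A) :=
    ⟨⟨by rw [hcompl]; exact hopen _ hA.compl.isOpen⟩, hopen _ hA.isOpen⟩
  rcases isClopen_iff.1 hclopen with h | h
  · exact absurd h (hne.image π).ne_empty
  · refine eq_univ_of_forall fun u => ?_
    obtain ⟨v, hv, hvu⟩ := h.ge (mem_univ (π u))
    exact hinv v hv u (hπ v u hvu)

variable {X : Type u} [TopologicalSpace X]

/-- The orbits with trivial group of germs through points near `p` and those through points near `q`
correspond to each other, with uniform constants. -/
def LocallyCorrespond (G : StructureGroupoid X) (E : Set (OpenPartialHomeomorph X X)) (p q : X) :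
    Prop :=
  ∃ C : ℕ, ∃ M N : Set X, IsOpen M ∧ IsOpen N ∧ p ∈ M ∧ q ∈ N ∧ ∀ x ∈ M, ∀ y ∈ N,
    HasTrivialGermGroup G x → HasTrivialGermGroup G y →
      CoarselyCorrespond (orbitDist G E) C (orbit G x) (orbit G y)

variable {G : StructureGroupoid X} {E : Set (OpenPartialHomeomorph X X)} {p q r : X}

/-- The point `q` may have nontrivial germs, so the comparison passes through a nearby point with
trivial germs, which density provides. -/
theorem LocallyCorrespond.trans (hs : IsSymmetric E) (hg : Generates E G)
    (hd : Dense {x | HasTrivialGermGroup G x}) (h : LocallyCorrespond G E p q)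
    (h' : LocallyCorrespond G E q r) : LocallyCorrespond G E p r := by
  obtain ⟨C, M, N, hM, hN, hp, hq, h⟩ := h
  obtain ⟨C', M', N', hM', hN', hq', hr, h'⟩ := h'
  obtain ⟨z, ⟨hzN, hzM'⟩, hz⟩ := hd.inter_open_nonempty _ (hN.inter hM') ⟨q, hq, hq'⟩
  exact ⟨_, M, N', hM, hN', hp, hr, fun x hx y hy htx hty =>
    CoarselyCorrespond.trans (isPseudoDistOn_orbit hs hg x) (isPseudoDistOn_orbit hs hg z)
      (isPseudoDistOn_orbit hs hg y) ((h x hx z hzN htx hz).mono (le_max_left C C'))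
      ((h' z hzM' y hy hz hty).mono (le_max_right C C'))⟩

theorem LocallyCorrespond.symm (h : LocallyCorrespond G E p q) : LocallyCorrespond G E q p := by
  obtain ⟨C, M, N, hM, hN, hp, hq, h⟩ := h
  exact ⟨C, N, M, hN, hM, hq, hp, fun x hx y hy hx' hy' => (h y hy x hx hy' hx').symm⟩

theorem isOpen_setOf_locallyCorrespond (G : StructureGroupoid X)
    (E : Set (OpenPartialHomeomorph X X)) (p : X) : IsOpen {q | LocallyCorrespond G E p q} := by
  refine isOpen_iff_mem_nhds.2 ?_
  rintro q ⟨C, M, N, hM, hN, hp, hq, h⟩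
  exact Filter.mem_of_superset (hN.mem_nhds hq) fun q' hq' => ⟨C, M, N, hM, hN, hp, hq', h⟩

/-- The neighbourhood of `q` is carried to one of `r` by an element of `G`, which does not change
the orbits involved. -/
theorem LocallyCorrespond.of_mem_orbit (h : LocallyCorrespond G E p q) (hr : r ∈ orbit G q) :
    LocallyCorrespond G E p r := by
  obtain ⟨C, M, N, hM, hN, hp, hq, h⟩ := h
  obtain ⟨k, hk, hqk, rfl⟩ := hr
  refine ⟨C, M, k.symm.source ∩ k.symm ⁻¹' N, hM, k.symm.isOpen_inter_preimage hN, hp,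
    ⟨k.map_source hqk, by rwa [mem_preimage, k.left_inv hqk]⟩, fun x hx y hy htx hty => ?_⟩
  have hyo : k.symm y ∈ orbit G y := ⟨k.symm, G.symm hk, hy.1, rfl⟩
  rw [← orbit_eq_of_mem hyo]
  exact h x hx _ hy.2 htx (hty.of_mem_orbit hyo)

theorem exists_coarselyCorrespond_of_isCompact {K : Set X} (hK : IsCompact K)
    (h : ∀ p q, LocallyCorrespond G E p q) : ∃ C : ℕ, ∀ x ∈ K, ∀ y ∈ K,
      HasTrivialGermGroup G x → HasTrivialGermGroup G y →
        CoarselyCorrespond (orbitDist G E) C (orbit G x) (orbit G y) := by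
  suffices h : ∃ C : ℕ, ∀ z ∈ K ×ˢ K, HasTrivialGermGroup G z.1 → HasTrivialGermGroup G z.2 →
      CoarselyCorrespond (orbitDist G E) C (orbit G z.1) (orbit G z.2) by
    obtain ⟨C, hC⟩ := h
    exact ⟨C, fun x hx y hy => hC (x, y) ⟨hx, hy⟩⟩
  refine (hK.prod hK).induction_on ?_ ?_ ?_ ?_
  · exact ⟨0, fun z hz => hz.elim⟩
  · rintro s t hst ⟨C, hC⟩
    exact ⟨C, fun z hz => hC z (hst hz)⟩
  · rintro s t ⟨C, hC⟩ ⟨D, hD⟩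
    refine ⟨max C D, ?_⟩
    rintro z (hz | hz) h1 h2
    exacts [(hC z hz h1 h2).mono (le_max_left _ _), (hD z hz h1 h2).mono (le_max_right _ _)]
  · rintro ⟨p, q⟩ -
    obtain ⟨C, M, N, hM, hN, hp, hq, h⟩ := h p q
    exact ⟨M ×ˢ N, mem_nhdsWithin_of_mem_nhds ((hM.prod hN).mem_nhds ⟨hp, hq⟩), C,
      fun z hz => h z.1 hz.1 z.2 hz.2⟩

end Connected

/-! ### Assembly of the theorem. -/

theorem exists_coarselyQuasiIsometricWith {Z : Type u} [MetricSpace Z] [LocallyCompactSpace Z]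
    (H : StructureGroupoid Z) [ClosedUnderRestriction H] (hse : IsStronglyEquicontinuous H)
    (hqe : IsQuasiEffective H) (hconn : PreconnectedSpace (OrbitSpace H))
    (U : Opens Z) (hUc : IsCompact (closure (U : Set Z))) (hUo : MeetsEveryOrbit H (U : Set Z))
    (E : Set (OpenPartialHomeomorph U U)) (hE : IsSystemOfCompactGeneration H U E)
    (hEr : IsRecurrent (restriction H U) E) :
    ∃ C K : ℝ, 0 < C ∧ 0 < K ∧ ∀ x y : U,
      HasTrivialGermGroup (restriction H U) x → HasTrivialGermGroup (restriction H U) y →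
      CoarselyQuasiIsometricWith (M := orbit (restriction H U) x) (M' := orbit (restriction H U) y)
        (fun p q => (orbitDist (restriction H U) E p q : ℝ))
        (fun p q => (orbitDist (restriction H U) E p q : ℝ)) C K := by
  have hs := hE.2.1
  have hg := hE.2.2.1
  obtain ⟨V, hVo, hVc, R, hR, hV⟩ := hEr
  have hV' : ∀ u : U, ∃ v ∈ V, Reach E ⌈R⌉₊ u v := fun u => by
    obtain ⟨h, hh, hu, hlen, huV⟩ := hV u
    exact ⟨h u, huV, (germLength_spec hs hg hh hu).mono
      (by exact_mod_cast (hlen.trans_le (Nat.le_ceil R)).le)⟩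
  obtain ⟨C₀, r, hr, hloc⟩ := exists_coarselyCorrespond_of_dist_lt hse hqe hUc hE hVc hV'
  have : LocallyCompactSpace U := U.isOpen.locallyCompactSpace
  have hdense := dense_hasTrivialGermGroup hs hg hE.1.countable
  have hrefl : ∀ p : U, LocallyCorrespond (restriction H U) E p p := fun p =>
    ⟨C₀, Metric.ball p (r / 2), Metric.ball p (r / 2), Metric.isOpen_ball, Metric.isOpen_ball,
      Metric.mem_ball_self (half_pos hr), Metric.mem_ball_self (half_pos hr),
      fun x hx y hy htx hty => hloc x y htx hty
        ((dist_triangle_right x y p).trans_lt (by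
          linarith [Metric.mem_ball.1 hx, Metric.mem_ball.1 hy]))⟩
  have hall : ∀ p q : U, LocallyCorrespond (restriction H U) E p q := by
    intro p
    have hcl : IsClopen {q | LocallyCorrespond (restriction H U) E p q} := by
      -- The complement of the class of `p` is open: a point of the class close to `q` would link
      -- `p` to `q`.
      refine ⟨⟨isOpen_iff_mem_nhds.2 fun q hq => ?_⟩, isOpen_setOf_locallyCorrespond _ _ p⟩
      filter_upwards [(isOpen_setOf_locallyCorrespond _ _ q).mem_nhds (hrefl q)] with q' hq' hpq
      exact hq (LocallyCorrespond.trans hs hg hdense hpq (LocallyCorrespond.symm hq'))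
    have huniv := eq_univ_of_isClopen_of_invariant hconn hUo hcl ⟨p, hrefl p⟩ fun x hx y hy => by
      obtain ⟨h, hh, hxh, hhx⟩ := hy
      exact LocallyCorrespond.of_mem_orbit hx (mem_orbit_restriction hh hxh hhx)
    exact fun q => huniv.ge (mem_univ q)
  -- Every orbit meets `V` by recurrence, so constants uniform over pairs in its compact closure
  -- serve all pairs of orbits.
  obtain ⟨C, hC⟩ := exists_coarselyCorrespond_of_isCompact hVc hall
  refine ⟨(2 * C * C + 4 * C + 1 : ℕ), (2 * C + 1 : ℕ), by positivity, by positivity,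
    fun x y hx hy => ?_⟩
  obtain ⟨x', hxV, hxx'⟩ := hV' x
  obtain ⟨y', hyV, hyy'⟩ := hV' y
  have hxo := hxx'.mem_orbit hg
  have hyo := hyy'.mem_orbit hg
  have key := hC x' (subset_closure hxV) y' (subset_closure hyV) (hx.of_mem_orbit hxo)
    (hy.of_mem_orbit hyo)
  rw [orbit_eq_of_mem hxo, orbit_eq_of_mem hyo] at key
  exact key.coarselyQuasiIsometricWith (isPseudoDistOn_orbit hs hg x) (isPseudoDistOn_orbit hs hg y)

end LocalPseudogroup

theorem theoremt {Z : Type u} [TopologicalSpace Z] [PolishSpace Z] [LocallyCompactSpace Z]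
    (H : StructureGroupoid Z) [ClosedUnderRestriction H]
    (hcg : LocalPseudogroup.IsCompactlyGenerated H)
    (hse : LocalPseudogroup.IsStronglyEquicontinuous H)
    (hqe : LocalPseudogroup.IsQuasiEffective H)
    (hconn : PreconnectedSpace (LocalPseudogroup.OrbitSpace H))
    (U : Opens Z) (hUc : IsCompact (closure (U : Set Z)))
    (hUo : LocalPseudogroup.MeetsEveryOrbit H (U : Set Z))
    (E : Set (OpenPartialHomeomorph U U))
    (hE : LocalPseudogroup.IsSystemOfCompactGeneration H U E)
    (hEr : LocalPseudogroup.IsRecurrent (LocalPseudogroup.restriction H U) E) :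
    ∃ C K : ℝ, 0 < C ∧ 0 < K ∧ ∀ x y : U,
      LocalPseudogroup.HasTrivialGermGroup (LocalPseudogroup.restriction H U) x →
      LocalPseudogroup.HasTrivialGermGroup (LocalPseudogroup.restriction H U) y →
      LocalPseudogroup.CoarselyQuasiIsometricWith
        (M := LocalPseudogroup.orbit (LocalPseudogroup.restriction H U) x)
        (M' := LocalPseudogroup.orbit (LocalPseudogroup.restriction H U) y)
        (fun p q => (LocalPseudogroup.orbitDist (LocalPseudogroup.restriction H U) E p q : ℝ))
        (fun p q => (LocalPseudogroup.orbitDist (LocalPseudogroup.restriction H U) E p q : ℝ))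
        C K := by
  let _ := TopologicalSpace.metrizableSpaceMetric Z
  exact LocalPseudogroup.exists_coarselyQuasiIsometricWith H hse hqe hconn U hUc hUo E hE hEr
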